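/- **Setting.** Let $P$ be a probability distribution on labeled examples $(x,y)\in X\times\{0,1\}$, let $\mathcal H$ be a finite nonempty class of measurable hypotheses $h:X\to\{0,1\}$ of VC dimension at most $d$, where $d\ge 1$, and let $D=(D_1,\dots,D_n)$, $n\ge 2$, be drawn iid from $P$. Put $\mathrm{err}(h)=P(h(x)\ne y)$ and $\widehat{\mathrm{err}}(h,D)=\frac1n|\{j: h \text{ misclassifies } D_j\}|$, and let $\alpha,\delta,\delta_0\in(0,1)$. Write $\rho=\sqrt{d\log(n/\delta_0)/n}$. **Mechanism.** The large margin mechanism $\mathrm{LMM}(\alpha,\delta,D)$ with universe $\mathcal H$, $K=|\mathcal H|$, and objective $f(h)=1-\widehat{\mathrm{err}}(h,D)$ works as follows. Let $f^{(r)}$ be the $r$-th highest value of $f$ on $\mathcal H$, let $t^{(r)}=\frac6n\bigl(1+\frac{\ln(3r/\delta)}{\alpha}\bigr)$ and $T^{(r)}=\frac{3}{n\alpha}\ln\frac{3}{2\delta}+\frac{6}{n\alpha}\ln\frac3\delta+\frac{12}{n\alpha}\ln\frac{3r(r+1)}{\delta}+t^{(r)}$. Draw independent Laplace variables $Z\sim\mathrm{Lap}(3/\alpha)$,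 $G\sim\mathrm{Lap}(6/\alpha)$, $Z_1,\dots,Z_{K-1}\sim\mathrm{Lap}(12/\alpha)$. Let $\ell$ be the least $\ell<K$ with $f^{(1)}+Z/n-f^{(\ell+1)}>(Z_\ell+G)/n+T^{(\ell)}$, or $\ell=K$ if there is none. Let $\mathcal U_\ell$ be a set of $\ell$ hypotheses with highest $f$ (ties broken arbitrarily), and return $h_{\mathrm{LMM}}\in\mathcal U_\ell$ drawn with probability proportional to $\exp(n\alpha f(h)/6)$. **Shells.** Let $c_0=c_0(\mathcal H,P,d,n,\delta_0)$ be the smallest (infimal) $c>0$ such that, with probability at least $1-\delta_0$, $|\widehat{\mathrm{err}}(h,D)-\mathrm{err}(h)|\le c\,\rho$ for all $h\in\mathcal H$. For $C_0>0$ and $C>0$ let $$\mathcal H(t)=\Bigl\{h\in\mathcal H:\ \mathrm{err}(h)\le\min_{h'\in\mathcal H}\mathrm{err}(h')+C_0\,t\,\rho\Bigr\},$$ and let $t^*=t^*(n)$ be the smallest positive integer $t$ with $\frac{\log|\mathcal H(t+1)|+\log(1/\delta)}{t}\le\frac{C_0\,\alpha\sqrt{d\,n\log n}}{C}$. **Claim.**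 There is an absolute constant $A>0$, and for every $\theta>0$ there is a constant $B=B(\theta)>0$, such that the following holds for all data as above, all tie-breaking rules, all $C\ge B$ and all $C_0\geq c_0$, $C_0>0$, for which $C_0\ge(1+\theta)c_0$ or $t^*(n)\ge2$. With probability at least $1-\delta_0-\delta$ over $D$ and the randomness of the mechanism, $$\mathrm{err}(h_{\mathrm{LMM}})\le\min_{h\in\mathcal H}\mathrm{err}(h)+A\left(\sqrt{\frac{d\log(n/\delta_0)}{n}}+\frac{\log(|\mathcal H(t^*(n)+1)|/\delta)}{\alpha n}\right).$$ -/

import Mathlib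

open MeasureTheory
open scoped ENNReal

noncomputable section

namespace PrivMax

/-! ### The large margin mechanism

In this section `H` is the finite universe of items, `f i` is the value `f(i, D)` of the item `i`
on the given dataset `D`, and `n` is the number of records of `D`. -/

/-- The centered Laplace distribution with scale `b > 0`. -/
def laplace (b : ℝ) : Measure ℝ :=
  volume.withDensity fun x => ENNReal.ofReal ((2 * b)⁻¹ * Real.exp (-|x| / b))

/-- The `ℓ`-th highest value (counted with multiplicity, `1 ≤ ℓ ≤ |H|`) of `f` on `H`:
the largest `v` such that at least `ℓ` items have value at least `v`. -/
def kthHighest {ι : Type*} (H : Finset ι) (f : ι → ℝ) (ℓ : ℕ) : ℝ :=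
  sSup {v : ℝ | ℓ ≤ (H.filter fun i => v ≤ f i).card}

/-- The quantity `t^(r)` of the mechanism. -/
def tThreshold (n : ℕ) (α δ : ℝ) (r : ℕ) : ℝ :=
  6 / n * (1 + Real.log (3 * r / δ) / α)

/-- The threshold `T^(r)` of the mechanism. -/
def bigThreshold (n : ℕ) (α δ : ℝ) (r : ℕ) : ℝ :=
  3 / (n * α) * Real.log (3 / (2 * δ)) + 6 / (n * α) * Real.log (3 / δ)
    + 12 / (n * α) * Real.log (3 * r * (r + 1) / δ) + tThreshold n α δ r

/-- The rank `ℓ` with which the while-loop ends, given the noise variables `Z`, `G` and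
`Z_1, …, Z_{K-1}` (`Zs r` is `Z_{r+1}`), where `K = |H|`: the first `ℓ < K` that passes the test,
and `K` if there is none. -/
def lmmRank {ι : Type*} (n : ℕ) (α δ : ℝ) (H : Finset ι) (f : ι → ℝ)
    (Z G : ℝ) (Zs : Fin (H.card - 1) → ℝ) : ℕ :=
  sInf ({H.card} ∪ {ℓ : ℕ | ∃ r : Fin (H.card - 1), ℓ = (r : ℕ) + 1 ∧
    (kthHighest H f 1 + Z / n) - kthHighest H f (ℓ + 1)
      > (Zs r + G) / n + bigThreshold n α δ ℓ})

/-- `U` consists of `ℓ` items of `H` with highest values of `f` (ties broken in some way). -/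
def IsTopSet {ι : Type*} (H : Finset ι) (f : ι → ℝ) (ℓ : ℕ) (U : Finset ι) : Prop :=
  U ⊆ H ∧ U.card = ℓ ∧ ∀ i ∈ U, ∀ j ∈ H, j ∉ U → f j ≤ f i

/-- The probability that the exponential mechanism on `U` with inverse temperature `β` returns
the item `i`: proportional to `1{i ∈ U} exp (β f i)`. -/
def expMech {ι : Type*} (β : ℝ) (f : ι → ℝ) (U : Finset ι) (i : ι) : ℝ :=
  (U : Set ι).indicator (fun i => Real.exp (β * f i)) i / ∑ j ∈ U, Real.exp (β * f j)

/-- The joint law of the independent noise variables `Z ∼ Lap(3/α)`, `G ∼ Lap(6/α)` and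
`Z_1, …, Z_{K-1} ∼ Lap(12/α)`. -/
def lmmNoise (α : ℝ) (K : ℕ) : Measure (ℝ × ℝ × (Fin (K - 1) → ℝ)) :=
  (laplace (3 / α)).prod ((laplace (6 / α)).prod (Measure.pi fun _ => laplace (12 / α)))

/-- The probability that the item returned by the large margin mechanism `LMM(α, δ, D)` lies
in `S`. Here `top ℓ` is the set of `ℓ` items with highest value that the tie-breaking rule
chooses. -/
def lmmProb {ι : Type*} (n : ℕ) (α δ : ℝ) (H : Finset ι) (f : ι → ℝ) (top : ℕ → Finset ι)
    (S : Set ι) : ℝ≥0∞ :=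
  ∫⁻ w, ∑ i ∈ H, S.indicator (fun i => ENNReal.ofReal
      (expMech (n * α / 6) f (top (lmmRank n α δ H f w.1 w.2.1 w.2.2)) i)) i
    ∂(lmmNoise α H.card)

/-! ### The learning problem

Hypotheses are functions `X → Bool`, a labeled example is an element of `X × Bool`, and `P` is the
distribution of a labeled example. -/

/-- The finite set `s` is shattered by `H`: every labeling of `s` is realized by some `h ∈ H`. -/
def Shatters {X : Type*} (H : Finset (X → Bool)) (s : Finset X) : Prop :=
  ∀ b : X → Bool, ∃ h ∈ H, ∀ x ∈ s, h x = b x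

/-- The VC dimension of a (nonempty) finite class: the largest size of a shattered set. -/
def vcDim {X : Type*} (H : Finset (X → Bool)) : ℕ :=
  sSup {k : ℕ | ∃ s : Finset X, s.card = k ∧ Shatters H s}

/-- The error of `h`: the probability that it misclassifies a random example. -/
def err {X : Type*} [MeasurableSpace X] (P : Measure (X × Bool)) (h : X → Bool) : ℝ :=
  P.real {z | h z.1 ≠ z.2}

/-- The empirical error of `h` on the dataset `D`. -/
def empErr {X : Type*} {n : ℕ} (h : X → Bool) (D : Fin n → X × Bool) : ℝ :=
  ((Finset.univ.filter fun j => h (D j).1 ≠ (D j).2).card : ℝ) / n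

/-- The least error `min_{h ∈ H} err(h)`. -/
def minErr {X : Type*} [MeasurableSpace X] (P : Measure (X × Bool)) (H : Finset (X → Bool))
    (hH : H.Nonempty) : ℝ :=
  H.inf' hH (err P)

/-- The rate `√(d log(n/δ₀)/n)`. -/
def rate (d n : ℕ) (δ₀ : ℝ) : ℝ :=
  Real.sqrt (d * Real.log (n / δ₀) / n)

/-- The smallest constant in the uniform convergence bound: the least `c` such that, with
probability at least `1 - δ₀` over `n` iid examples, `|empErr h D - err h| ≤ c √(d log(n/δ₀)/n)`
for all `h ∈ H`. -/
def ucConstant {X : Type*} [MeasurableSpace X] (P : Measure (X × Bool)) (H : Finset (X → Bool))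
    (d n : ℕ) (δ₀ : ℝ) : ℝ :=
  sInf {c : ℝ | 0 < c ∧ ENNReal.ofReal (1 - δ₀) ≤
    (Measure.pi fun _ : Fin n => P)
      {D | ∀ h ∈ H, |empErr h D - err P h| ≤ c * rate d n δ₀}}

/-- The `t`-th shell of `H`, with shell width `C₀ √(d log(n/δ₀)/n)`. -/
def shell {X : Type*} [MeasurableSpace X] (P : Measure (X × Bool)) (H : Finset (X → Bool))
    (hH : H.Nonempty) (d n : ℕ) (δ₀ C₀ : ℝ) (t : ℕ) : Finset (X → Bool) :=
  H.filter fun h => err P h ≤ minErr P H hH + C₀ * t * rate d n δ₀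

/-- `t*(n)`: the least positive integer `t` with
`(log |H(t+1)| + log(1/δ)) / t ≤ C₀ α √(d n log n) / C`. Such `t` exist as soon as
`α, C₀, C > 0`, `d ≥ 1` and `n ≥ 2`. -/
def tStar {X : Type*} [MeasurableSpace X] (P : Measure (X × Bool)) (H : Finset (X → Bool))
    (hH : H.Nonempty) (d n : ℕ) (α δ δ₀ C₀ C : ℝ) : ℕ :=
  sInf {t : ℕ | 0 < t ∧
    (Real.log ((shell P H hH d n δ₀ C₀ (t + 1)).card : ℝ) + Real.log (1 / δ)) / t
      ≤ C₀ * α * Real.sqrt (d * n * Real.log n) / C}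

end PrivMax

end

open PrivMax

namespace PrivMax

/-! ### Uniform convergence for a class of bounded VC dimension -/

/-! Two facts combine: empirical errors are uniformly accurate up to `c₀ * ρ`, and the mechanism is
accurate once few items score close to the top. Write `t` for `t*(n)`, `m` for the size of the shell
`t + 1`, and `λ = log (m / δ)`.

On the uniform convergence event every hypothesis outside that shell scores at least `(C₀ (t + 1) -
2 c₀) ρ` below the best one. Either alternative of the assumption makes this at least `κ C₀ t ρ`,
with `κ > 0` depending only on `θ` (`shell_margin`, `kthHighest_shell_le`). The choice of `t` gives
`n α C₀ t ρ ≥ C λ`, so for large `C` the gap after rank `m` beats noise and threshold: with high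
probability the loop ends at rank at most `m`, and the exponential mechanism then loses only `O(λ /
(α n))` (`lmmProb_of_margin`).

The gap must also absorb absolute constants, which `λ` does not dominate when `m = 1` and `δ` is
near `1`. But for `δ ≥ 1/2`, whatever the data, the loop ends at rank one and returns an empirical
minimizer with probability at least `p = exp (-70) / 8` (`lmmProb_of_half_le`). This suffices if `1
- δ ≤ p`; otherwise `λ ≥ 1 - δ > p`, and constants are `O(λ)`.

`A` can be absolute because `c₀ ≤ 8`, by the Vapnik–Chervonenkis inequality (symmetrization plus
Sauer's lemma). That `c₀` itself is admissible follows from continuity of the measure. -/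

/-- The `0`-`1` loss of the hypothesis `h` on a labeled example. -/
noncomputable def loss {X : Type*} (h : X → Bool) (z : X × Bool) : ℝ := if h z.1 ≠ z.2 then 1 else 0

/-- The sign attached to a boolean. -/
noncomputable def signOf (b : Bool) : ℝ := if b then 1 else -1

lemma loss_nonneg {X : Type*} (h : X → Bool) (z : X × Bool) : 0 ≤ loss h z := by
  unfold loss; split_ifs <;> norm_num

lemma loss_le_one {X : Type*} (h : X → Bool) (z : X × Bool) : loss h z ≤ 1 := by
  unfold loss; split_ifs <;> norm_num

lemma measurableSet_misclassified {X : Type*} [MeasurableSpace X] {h : X → Bool}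
    (hh : Measurable h) : MeasurableSet {z : X × Bool | h z.1 ≠ z.2} :=
  (measurableSet_eq_fun (hh.comp measurable_fst) measurable_snd).compl

lemma measurable_loss {X : Type*} [MeasurableSpace X] {h : X → Bool} (hh : Measurable h) :
    Measurable (loss h) :=
  Measurable.ite (measurableSet_misclassified hh) measurable_const measurable_const

lemma integral_loss {X : Type*} [MeasurableSpace X] (P : Measure (X × Bool)) {h : X → Bool}
    (hh : Measurable h) : ∫ z, loss h z ∂P = err P h := by
  have : loss h = {z : X × Bool | h z.1 ≠ z.2}.indicator 1 := by
    ext z; simp [loss, Set.indicator_apply]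
  rw [this, integral_indicator_one (measurableSet_misclassified hh)]
  rfl

lemma empErr_eq_sum_loss {X : Type*} {n : ℕ} (h : X → Bool) (D : Fin n → X × Bool) :
    empErr h D = (∑ j, loss h (D j)) / n := by
  simp only [empErr, loss, Finset.sum_boole]

lemma measurable_empErr {X : Type*} [MeasurableSpace X] {n : ℕ} {h : X → Bool}
    (hh : Measurable h) : Measurable fun D : Fin n → X × Bool => empErr h D := by
  simp only [empErr_eq_sum_loss]
  have := measurable_loss hh
  fun_prop

/-! #### Concentration of signed sums -/

/-- The sum over signs factorizes over coordinates, and each factor is `2 cosh (l a_j) ≤ 2 exp (l² /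
2)`. -/
lemma sum_exp_signed_le {n : ℕ} (a : Fin n → ℝ) (ha : ∀ j, |a j| ≤ 1) (l : ℝ) :
    ∑ σ : Fin n → Bool, Real.exp (l * ∑ j, signOf (σ j) * a j)
      ≤ 2 ^ n * Real.exp (n * (l ^ 2 / 2)) := by
  have h1 : ∀ σ : Fin n → Bool, Real.exp (l * ∑ j, signOf (σ j) * a j)
      = ∏ j, Real.exp (l * (signOf (σ j) * a j)) := by
    intro σ
    rw [Finset.mul_sum, Real.exp_sum]
  simp only [h1]
  have h2 := Finset.prod_univ_sum (fun _ : Fin n => (Finset.univ : Finset Bool))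
    (fun j b => Real.exp (l * (signOf b * a j)))
  rw [Fintype.piFinset_univ] at h2
  rw [← h2]
  have h3 : ∀ j, ∑ b : Bool, Real.exp (l * (signOf b * a j)) ≤ 2 * Real.exp (l ^ 2 / 2) := by
    intro j
    have h4 : ∑ b : Bool, Real.exp (l * (signOf b * a j)) = 2 * Real.cosh (l * a j) := by
      rw [Real.cosh_eq]; simp [signOf]; ring_nf
    rw [h4]
    have h5 : (l * a j) ^ 2 ≤ l ^ 2 := by
      rw [mul_pow]
      have : a j ^ 2 ≤ 1 := by
        rw [← sq_abs]; exact pow_le_one₀ (abs_nonneg _) (ha j)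
      nlinarith [sq_nonneg l]
    have := (Real.cosh_le_exp_half_sq (l * a j)).trans
      (Real.exp_le_exp.2 (by linarith : (l * a j) ^ 2 / 2 ≤ l ^ 2 / 2))
    linarith
  calc ∏ j, ∑ b : Bool, Real.exp (l * (signOf b * a j))
      ≤ ∏ _j : Fin n, 2 * Real.exp (l ^ 2 / 2) :=
        Finset.prod_le_prod (fun j _ => Finset.sum_nonneg fun b _ => (Real.exp_pos _).le)
          fun j _ => h3 j
    _ = 2 ^ n * Real.exp (n * (l ^ 2 / 2)) := by
        simp [mul_pow, Real.exp_nat_mul]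

/-- Chernoff's method for the counting measure, with the optimal parameter `l = s / n`. -/
lemma card_signed_gt_le {n : ℕ} (hn : 0 < n) (a : Fin n → ℝ) (ha : ∀ j, |a j| ≤ 1) (s : ℝ)
    (hs : 0 ≤ s) :
    ((Finset.univ.filter fun σ : Fin n → Bool => s < ∑ j, signOf (σ j) * a j).card : ℝ)
      ≤ 2 ^ n * Real.exp (-s ^ 2 / (2 * n)) := by
  have hn' : (0 : ℝ) < n := by exact_mod_cast hn
  set l : ℝ := s / n with hl
  have hl0 : 0 ≤ l := by positivity
  have h1 : ((Finset.univ.filter fun σ : Fin n → Bool => s < ∑ j, signOf (σ j) * a j).card : ℝ)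
      * Real.exp (l * s) ≤ ∑ σ : Fin n → Bool, Real.exp (l * ∑ j, signOf (σ j) * a j) := by
    set T := Finset.univ.filter fun σ : Fin n → Bool => s < ∑ j, signOf (σ j) * a j with hT
    have h0 : ∀ σ ∈ T, Real.exp (l * s) ≤ Real.exp (l * ∑ j, signOf (σ j) * a j) := fun σ hσ =>
      Real.exp_le_exp.2 (mul_le_mul_of_nonneg_left (Finset.mem_filter.1 hσ).2.le hl0)
    have h0' := Finset.sum_le_sum h0
    rw [Finset.sum_const, nsmul_eq_mul] at h0'
    exact h0'.trans (Finset.sum_le_sum_of_subset_of_nonneg (Finset.subset_univ T)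
      fun σ _ _ => (Real.exp_pos _).le)
  have h2 := h1.trans (sum_exp_signed_le a ha l)
  rw [← le_div_iff₀ (Real.exp_pos _), mul_div_assoc, ← Real.exp_sub] at h2
  have h3 : n * (l ^ 2 / 2) - l * s = -s ^ 2 / (2 * n) := by
    rw [hl]; field_simp; ring
  rwa [h3] at h2

lemma card_abs_signed_gt_le {n : ℕ} (hn : 0 < n) (a : Fin n → ℝ) (ha : ∀ j, |a j| ≤ 1) (s : ℝ)
    (hs : 0 ≤ s) :
    ((Finset.univ.filter fun σ : Fin n → Bool => s < |∑ j, signOf (σ j) * a j|).card : ℝ)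
      ≤ 2 ^ n * (2 * Real.exp (-s ^ 2 / (2 * n))) := by
  have h1 := card_signed_gt_le hn a ha s hs
  have h2 := card_signed_gt_le hn (fun j => -a j) (by simpa using ha) s hs
  have h3 : (Finset.univ.filter fun σ : Fin n → Bool => s < |∑ j, signOf (σ j) * a j|)
      ⊆ (Finset.univ.filter fun σ : Fin n → Bool => s < ∑ j, signOf (σ j) * a j) ∪
        (Finset.univ.filter fun σ : Fin n → Bool => s < ∑ j, signOf (σ j) * -a j) := by
    intro σ hσ
    simp only [Finset.mem_filter, Finset.mem_univ, true_and, Finset.mem_union, mul_neg,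
      Finset.sum_neg_distrib] at hσ ⊢
    exact lt_abs.1 hσ
  have h4 : ((Finset.univ.filter fun σ : Fin n → Bool =>
      s < |∑ j, signOf (σ j) * a j|).card : ℝ) ≤ _ :=
    Nat.cast_le.2 ((Finset.card_le_card h3).trans (Finset.card_union_le _ _))
  push_cast at h4
  linarith

/-! #### The growth function -/

lemma sum_choose_le_succ_pow (N d : ℕ) : ∑ k ∈ Finset.range (d + 1), N.choose k ≤ (N + 1) ^ d := by
  rw [add_pow]
  refine Finset.sum_le_sum fun k hk => ?_
  have h1 : 0 < d.choose k := Nat.choose_pos (by simpa [Nat.lt_succ_iff] using hk)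
  simpa using (Nat.choose_le_pow N k).trans (Nat.le_mul_of_pos_right _ h1)

/-- The supremum is meaningful because shattering `k` points takes `2 ^ k` distinct hypotheses, so
`k < 2 ^ k ≤ |H|`. -/
lemma card_le_vcDim {X : Type*} (H : Finset (X → Bool)) {s : Finset X} (hs : Shatters H s) :
    s.card ≤ vcDim H := by
  classical
  refine le_csSup ⟨H.card, ?_⟩ ⟨s, rfl, hs⟩
  rintro k ⟨s, rfl, hs⟩
  have : s.powerset ⊆ H.image fun h => s.filter fun x => h x = true := by
    intro t ht
    rw [Finset.mem_powerset] at ht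
    obtain ⟨h, hh, hx⟩ := hs fun x => decide (x ∈ t)
    refine Finset.mem_image.2 ⟨h, hh, ?_⟩
    ext x
    simp only [Finset.mem_filter]
    constructor
    · rintro ⟨h1, h2⟩
      simpa [hx x h1] using h2
    · intro h1
      exact ⟨ht h1, by simpa [hx x (ht h1)] using h1⟩
  have h2 := (Finset.card_le_card this).trans Finset.card_image_le
  rw [Finset.card_powerset] at h2
  exact Nat.lt_two_pow_self.le.trans h2

/-- Sauer's lemma for the traces of `H` on a finite set. -/
lemma card_trace_le {X : Type*} [DecidableEq X] (H : Finset (X → Bool)) {d : ℕ} (hd : vcDim H ≤ d)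
    (V : Finset X) :
    (H.image fun h => V.filter fun x => h x = true).card ≤ (V.card + 1) ^ d := by
  set F := H.image fun h => V.filter fun x => h x = true with hF
  -- Pajor's form of Sauer's lemma: a family has at most as many members as sets it shatters, and
  -- those have at most `d` elements.
  refine (Finset.card_le_card_shatterer F).trans ?_
  have hsub : F.shatterer ⊆ (Finset.range (d + 1)).biUnion fun k => V.powersetCard k := by
    intro s hs
    rw [Finset.mem_shatterer] at hs
    have hsV : s ⊆ V := by
      obtain ⟨u, hu, hsu⟩ := hs (Finset.Subset.refl s)
      obtain ⟨h, -, rfl⟩ := Finset.mem_image.1 hu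
      exact (Finset.inter_eq_left.1 hsu).trans (Finset.filter_subset _ _)
    have hsh : Shatters H s := by
      intro b
      obtain ⟨u, hu, hsu⟩ := hs (Finset.filter_subset (fun x => b x = true) s)
      obtain ⟨h, hh, rfl⟩ := Finset.mem_image.1 hu
      refine ⟨h, hh, fun x hx => ?_⟩
      have := congrArg (x ∈ ·) hsu
      simp only [Finset.mem_inter, Finset.mem_filter, hx, hsV hx, true_and, eq_iff_iff] at this
      exact Bool.eq_iff_iff.2 this
    rw [Finset.mem_biUnion]
    exact ⟨s.card, Finset.mem_range.2 (Nat.lt_succ_of_le ((card_le_vcDim H hsh).trans hd)),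
      Finset.mem_powersetCard.2 ⟨hsV, rfl⟩⟩
  refine (Finset.card_le_card hsub).trans (Finset.card_biUnion_le.trans ?_)
  simp only [Finset.card_powersetCard]
  exact sum_choose_le_succ_pow _ _

/-! #### Symmetrization -/

/-- On a fixed double sample the losses depend only on the trace of `h` on at most `2n` points, so a
union bound over traces, not over `H`, suffices. -/
lemma card_swaps_le {X : Type*} (H : Finset (X → Bool)) {d n : ℕ} (hd : vcDim H ≤ d) (hn : 0 < n)
    (w : Fin n → (X × Bool) × (X × Bool)) (s : ℝ) (hs : 0 ≤ s) :
    ((Finset.univ.filter fun σ : Fin n → Bool =>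
      ∃ h ∈ H, s < |∑ j, signOf (σ j) * (loss h (w j).1 - loss h (w j).2)|).card : ℝ)
      ≤ 2 ^ n * ((2 * n + 1) ^ d * (2 * Real.exp (-s ^ 2 / (2 * n)))) := by
  classical
  set V : Finset X := (Finset.univ.image fun j => (w j).1.1) ∪
    (Finset.univ.image fun j => (w j).2.1) with hV
  have hVcard : V.card ≤ 2 * n := by
    refine (Finset.card_union_le _ _).trans ?_
    have h1 := Finset.card_image_le (s := Finset.univ) (f := fun j => (w j).1.1)
    have h2 := Finset.card_image_le (s := Finset.univ) (f := fun j => (w j).2.1)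
    simp only [Finset.card_univ, Fintype.card_fin] at h1 h2
    omega
  set F := H.image fun h => V.filter fun x => h x = true with hF
  have hFcard : (F.card : ℝ) ≤ (2 * n + 1) ^ d := by
    have h1 := (card_trace_le H hd V).trans
      (Nat.pow_le_pow_left (Nat.add_le_add_right hVcard 1) d)
    exact_mod_cast h1
  set g : Finset X → X → Bool := fun p x => decide (x ∈ p) with hg
  have hsub : (Finset.univ.filter fun σ : Fin n → Bool =>
      ∃ h ∈ H, s < |∑ j, signOf (σ j) * (loss h (w j).1 - loss h (w j).2)|) ⊆
      F.biUnion fun p => Finset.univ.filter fun σ : Fin n → Bool =>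
        s < |∑ j, signOf (σ j) * (loss (g p) (w j).1 - loss (g p) (w j).2)| := by
    intro σ hσ
    obtain ⟨h, hh, hlt⟩ := (Finset.mem_filter.1 hσ).2
    refine Finset.mem_biUnion.2 ⟨_, Finset.mem_image_of_mem _ hh, ?_⟩
    refine Finset.mem_filter.2 ⟨Finset.mem_univ _, ?_⟩
    have key : ∀ z : X × Bool, z.1 ∈ V → loss (g (V.filter fun x => h x = true)) z = loss h z := by
      intro z hz
      simp [loss, hg, hz]
    have k1 : ∀ j, (w j).1.1 ∈ V := fun j =>
      Finset.mem_union_left _ (Finset.mem_image_of_mem _ (Finset.mem_univ j))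
    have k2 : ∀ j, (w j).2.1 ∈ V := fun j =>
      Finset.mem_union_right _ (Finset.mem_image_of_mem (fun j => (w j).2.1) (Finset.mem_univ j))
    simpa only [key _ (k1 _), key _ (k2 _)] using hlt
  have h1 : ((Finset.univ.filter fun σ : Fin n → Bool =>
      ∃ h ∈ H, s < |∑ j, signOf (σ j) * (loss h (w j).1 - loss h (w j).2)|).card : ℝ) ≤
      ∑ p ∈ F, ((Finset.univ.filter fun σ : Fin n → Bool =>
        s < |∑ j, signOf (σ j) * (loss (g p) (w j).1 - loss (g p) (w j).2)|).card : ℝ) := by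
    exact_mod_cast (Finset.card_le_card hsub).trans Finset.card_biUnion_le
  refine h1.trans ((Finset.sum_le_card_nsmul F _ _ fun p _ =>
    card_abs_signed_gt_le hn _ (fun j => ?_) s hs).trans ?_)
  · have a1 := loss_nonneg (g p) (w j).1
    have a2 := loss_nonneg (g p) (w j).2
    have a3 := loss_le_one (g p) (w j).1
    have a4 := loss_le_one (g p) (w j).2
    exact abs_le.2 ⟨by linarith, by linarith⟩
  · rw [nsmul_eq_mul]
    have := Real.exp_pos (-s ^ 2 / (2 * n))
    calc (F.card : ℝ) * (2 ^ n * (2 * Real.exp (-s ^ 2 / (2 * n))))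
        ≤ (2 * n + 1) ^ d * (2 ^ n * (2 * Real.exp (-s ^ 2 / (2 * n)))) :=
          mul_le_mul_of_nonneg_right hFcard (by positivity)
      _ = _ := by ring

/-- Swapping the two members of any of the pairs preserves the law. Averaging over all `2 ^ n` swaps
reduces the claim to the count for each fixed double sample. -/
lemma measure_double_sample_le {X : Type*} [MeasurableSpace X] (P : Measure (X × Bool))
    [IsProbabilityMeasure P] (H : Finset (X → Bool)) (hm : ∀ h ∈ H, Measurable h) {d n : ℕ}
    (hd : vcDim H ≤ d) (hn : 0 < n) (s : ℝ) (hs : 0 ≤ s) :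
    (Measure.pi fun _ : Fin n => P.prod P)
      {w | ∃ h ∈ H, s < |∑ j, (loss h (w j).1 - loss h (w j).2)|}
      ≤ ENNReal.ofReal ((2 * n + 1) ^ d * (2 * Real.exp (-s ^ 2 / (2 * n)))) := by
  classical
  set ν := Measure.pi fun _ : Fin n => P.prod P with hν
  set S : Set (Fin n → (X × Bool) × (X × Bool)) :=
    {w | ∃ h ∈ H, s < |∑ j, (loss h (w j).1 - loss h (w j).2)|} with hS
  set c : ℝ := (2 * n + 1) ^ d * (2 * Real.exp (-s ^ 2 / (2 * n))) with hc
  have hSm : MeasurableSet S := by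
    have : S = ⋃ h ∈ H, {w | s < |∑ j, (loss h (w j).1 - loss h (w j).2)|} := by
      ext w; simp [hS]
    rw [this]
    refine Finset.measurableSet_biUnion _ fun h hh => ?_
    have := measurable_loss (hm h hh)
    exact measurableSet_lt measurable_const (by fun_prop)
  set Φ : (Fin n → Bool) → (Fin n → (X × Bool) × (X × Bool)) → Fin n → (X × Bool) × (X × Bool) :=
    fun σ w j => (if σ j then id else Prod.swap) (w j) with hΦ
  have hΦm : ∀ σ, MeasurePreserving (Φ σ) ν ν := by
    intro σ
    refine measurePreserving_pi (fun _ => P.prod P) (fun _ => P.prod P)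
      (f := fun j => if σ j then id else Prod.swap) fun j => ?_
    by_cases hσ : σ j
    · simpa [hσ] using MeasurePreserving.id (P.prod P)
    · simpa [hσ] using Measure.measurePreserving_swap (μ := P) (ν := P)
  have h1 : ∑ σ : Fin n → Bool, ν (Φ σ ⁻¹' S) = 2 ^ n * ν S := by
    simp [(hΦm _).measure_preimage hSm.nullMeasurableSet]
  have h2 : ∑ σ : Fin n → Bool, ν (Φ σ ⁻¹' S)
      = ∫⁻ w, ∑ σ : Fin n → Bool, (Φ σ ⁻¹' S).indicator (fun _ => (1 : ℝ≥0∞)) w ∂ν := by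
    rw [lintegral_finsetSum]
    · refine Finset.sum_congr rfl fun σ _ => ?_
      exact (lintegral_indicator_one ((hΦm σ).measurable hSm)).symm
    · exact fun σ _ => measurable_const.indicator ((hΦm σ).measurable hSm)
  have h3 : ∀ w, ∑ σ : Fin n → Bool, (Φ σ ⁻¹' S).indicator (fun _ => (1 : ℝ≥0∞)) w
      ≤ ENNReal.ofReal (2 ^ n * c) := by
    intro w
    have e1 : ∀ σ, w ∈ Φ σ ⁻¹' S ↔
        ∃ h ∈ H, s < |∑ j, signOf (σ j) * (loss h (w j).1 - loss h (w j).2)| := by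
      intro σ
      have : ∀ (h : X → Bool) (j), loss h (Φ σ w j).1 - loss h (Φ σ w j).2
          = signOf (σ j) * (loss h (w j).1 - loss h (w j).2) := by
        intro h j
        by_cases hσ : σ j <;> simp [hΦ, hσ, signOf]
      simp only [Set.mem_preimage, hS, Set.mem_ofPred_eq, this]
    have e2 := card_swaps_le H hd hn w s hs
    rw [← hc] at e2
    simp only [Set.indicator_apply, e1, Finset.sum_boole]
    rw [← ENNReal.ofReal_natCast]
    exact ENNReal.ofReal_le_ofReal e2
  have h4 : 2 ^ n * ν S ≤ 2 ^ n * ENNReal.ofReal c := by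
    rw [← h1, h2]
    refine (lintegral_mono h3).trans ?_
    rw [lintegral_const, measure_univ, mul_one, ENNReal.ofReal_mul (by positivity),
      ENNReal.ofReal_pow (by norm_num), ENNReal.ofReal_ofNat]
  exact (ENNReal.mul_le_mul_iff_right (by simp) (by simp)).1 h4

/-- Chebyshev's inequality for the empirical error. -/
lemma measure_empErr_deviation_le_half {X : Type*} [MeasurableSpace X] (P : Measure (X × Bool))
    [IsProbabilityMeasure P] {h : X → Bool} (hh : Measurable h) {n : ℕ} (hn : 0 < n) (ε : ℝ)
    (hε : 0 < ε) (hnε : 2 ≤ n * ε ^ 2) :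
    (Measure.pi fun _ : Fin n => P) {D | ε / 2 ≤ |empErr h D - err P h|} ≤ ENNReal.ofReal (1 / 2) := by
  have hn' : (0 : ℝ) < n := by exact_mod_cast hn
  set μ := Measure.pi fun _ : Fin n => P with hμ
  have hL : MemLp (loss h) 2 P :=
    MemLp.of_bound (measurable_loss hh).aestronglyMeasurable 1
      (Filter.Eventually.of_forall fun z => by
        rw [Real.norm_eq_abs, abs_of_nonneg (loss_nonneg h z)]; exact loss_le_one h z)
  have hLj : ∀ j, MemLp (fun D : Fin n → X × Bool => loss h (D j)) 2 μ := fun j =>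
    hL.comp_measurePreserving (measurePreserving_eval (fun _ : Fin n => P) j)
  set Y : (Fin n → X × Bool) → ℝ := ∑ j, fun D => loss h (D j) with hY
  have hYL : MemLp Y 2 μ := memLp_finsetSum' _ fun j _ => hLj j
  have hvar : ProbabilityTheory.variance Y μ ≤ n / 4 := by
    rw [hY, hμ, ProbabilityTheory.variance_sum_pi fun _ => hL]
    have := ProbabilityTheory.variance_le_sq_of_bounded (μ := P) (a := 0) (b := 1) (X := loss h)
      (Filter.Eventually.of_forall fun z => ⟨loss_nonneg h z, loss_le_one h z⟩)
      (measurable_loss hh).aemeasurable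
    simp only [Finset.sum_const, Finset.card_univ, Fintype.card_fin, nsmul_eq_mul]
    nlinarith
  have hint : ∫ D, Y D ∂μ = n * err P h := by
    simp only [hY, Finset.sum_apply]
    rw [integral_finsetSum _ fun j _ => (hLj j).integrable one_le_two]
    have : ∀ j, ∫ D : Fin n → X × Bool, loss h (D j) ∂μ = err P h := by
      intro j
      rw [← integral_loss P hh]
      have hmp := measurePreserving_eval (fun _ : Fin n => P) j
      have := integral_map (μ := μ) hmp.measurable.aemeasurable
        (measurable_loss hh).aestronglyMeasurable
      rw [hmp.map_eq] at this
      exact this.symm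
    simp [this]
  have h1 := ProbabilityTheory.meas_ge_le_variance_div_sq hYL (c := n * ε / 2) (by positivity)
  rw [hint] at h1
  have h2 : {D : Fin n → X × Bool | ε / 2 ≤ |empErr h D - err P h|}
      = {D | n * ε / 2 ≤ |Y D - n * err P h|} := by
    ext D
    have : Y D - n * err P h = n * (empErr h D - err P h) := by
      rw [empErr_eq_sum_loss, hY, Finset.sum_apply]; field_simp
    simp only [Set.mem_ofPred_eq, this, abs_mul, abs_of_pos hn', mul_div_assoc]
    exact (mul_le_mul_iff_right₀ hn').symm
  rw [h2]
  refine h1.trans (ENNReal.ofReal_le_ofReal ?_)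
  rw [div_le_iff₀ (by positivity)]
  nlinarith

/-- The Vapnik–Chervonenkis inequality. -/
lemma measure_exists_deviation_le {X : Type*} [MeasurableSpace X] (P : Measure (X × Bool))
    [IsProbabilityMeasure P] (H : Finset (X → Bool)) (hm : ∀ h ∈ H, Measurable h) {d n : ℕ}
    (hd : vcDim H ≤ d) (hn : 0 < n) (ε : ℝ) (hε : 0 < ε) (hnε : 2 ≤ n * ε ^ 2) :
    (Measure.pi fun _ : Fin n => P) {D | ∃ h ∈ H, ε < |empErr h D - err P h|}
      ≤ ENNReal.ofReal (4 * (2 * n + 1) ^ d * Real.exp (-(n * ε ^ 2 / 8))) := by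
  have hn' : (0 : ℝ) < n := by exact_mod_cast hn
  set μ := Measure.pi fun _ : Fin n => P with hμ
  set A : Set (Fin n → X × Bool) := {D | ∃ h ∈ H, ε < |empErr h D - err P h|} with hA
  have hAm : MeasurableSet A := by
    have : A = ⋃ h ∈ H, {D | ε < |empErr h D - err P h|} := by
      ext D; simp [hA]
    rw [this]
    refine Finset.measurableSet_biUnion _ fun h hh => ?_
    have := measurable_empErr (n := n) (hm h hh)
    exact measurableSet_lt measurable_const (by fun_prop)
  set S : Set ((Fin n → X × Bool) × (Fin n → X × Bool)) :=
    {q | ∃ h ∈ H, n * ε / 2 < |∑ j, (loss h (q.1 j) - loss h (q.2 j))|} with hS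
  have hSm : MeasurableSet S := by
    have : S = ⋃ h ∈ H, {q | n * ε / 2 < |∑ j, (loss h (q.1 j) - loss h (q.2 j))|} := by
      ext D; simp [hS]
    rw [this]
    refine Finset.measurableSet_biUnion _ fun h hh => ?_
    have := measurable_loss (hm h hh)
    exact measurableSet_lt measurable_const (by fun_prop)
  have hS1 : (μ.prod μ) S
      ≤ ENNReal.ofReal ((2 * n + 1) ^ d * (2 * Real.exp (-(n * ε / 2) ^ 2 / (2 * n)))) := by
    have h1 := measure_double_sample_le P H hm hd hn (n * ε / 2) (by positivity)
    have h2 := measurePreserving_arrowProdEquivProdArrow (X × Bool) (X × Bool) (Fin n)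
      (fun _ => P) (fun _ => P)
    rw [← h2.measure_preimage hSm.nullMeasurableSet]
    exact h1
  -- Ghost sample: if `h` deviates by more than `ε` on `D`, then with probability at least one half
  -- it deviates by less than `ε / 2` on an independent `D'`, so the two samples disagree by more
  -- than `ε / 2`.
  have hhalf : ∀ D ∈ A, ENNReal.ofReal (1 / 2) ≤ μ (Prod.mk D ⁻¹' S) := by
    rintro D ⟨h, hh, hD⟩
    have h1 := measure_empErr_deviation_le_half P (hm h hh) hn ε hε hnε
    set Bd : Set (Fin n → X × Bool) := {D | ε / 2 ≤ |empErr h D - err P h|} with hBd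
    have hBm : MeasurableSet Bd := by
      have := measurable_empErr (n := n) (hm h hh)
      exact measurableSet_le measurable_const (by fun_prop)
    have h2 : Bdᶜ ⊆ Prod.mk D ⁻¹' S := by
      intro D' hD'
      refine ⟨h, hh, ?_⟩
      have h3 : |empErr h D' - err P h| < ε / 2 := not_le.1 hD'
      have h4 : ∑ j, (loss h (D j) - loss h (D' j))
          = n * ((empErr h D - err P h) - (empErr h D' - err P h)) := by
        rw [empErr_eq_sum_loss, empErr_eq_sum_loss, Finset.sum_sub_distrib]; field_simp; ring
      have h5 := abs_sub_abs_le_abs_sub (empErr h D - err P h) (empErr h D' - err P h)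
      simp only [h4, abs_mul, abs_of_pos hn', mul_div_assoc]
      exact mul_lt_mul_of_pos_left (by linarith) hn'
    refine le_trans ?_ (measure_mono h2)
    rw [prob_compl_eq_one_sub hBm]
    refine le_trans ?_ (tsub_le_tsub_left h1 1)
    rw [← ENNReal.ofReal_one, ← ENNReal.ofReal_sub _ (by norm_num)]
    norm_num
  have hS2 : ENNReal.ofReal (1 / 2) * μ A ≤ (μ.prod μ) S := by
    rw [Measure.prod_apply hSm, ← setLIntegral_const]
    exact (setLIntegral_mono' hAm hhalf).trans (setLIntegral_le_lintegral _ _)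
  have h3 := hS2.trans hS1
  calc μ A = ENNReal.ofReal 2 * (ENNReal.ofReal (1 / 2) * μ A) := by
        rw [← mul_assoc, ← ENNReal.ofReal_mul (by norm_num)]; norm_num
    _ ≤ ENNReal.ofReal 2 *
        ENNReal.ofReal ((2 * n + 1) ^ d * (2 * Real.exp (-(n * ε / 2) ^ 2 / (2 * n)))) := by
        gcongr
    _ = _ := by
        rw [← ENNReal.ofReal_mul (by norm_num)]
        have : -(n * ε / 2) ^ 2 / (2 * n) = -(n * ε ^ 2 / 8) := by field_simp; ring
        rw [this]
        ring_nf

lemma log_ratio_pos {n : ℕ} (hn : 2 ≤ n) {δ₀ : ℝ} (h0 : 0 < δ₀) (h1 : δ₀ < 1) :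
    Real.log n ≤ Real.log (n / δ₀) ∧ 1 / 2 < Real.log n := by
  have hn' : (2 : ℝ) ≤ n := by exact_mod_cast hn
  constructor
  · refine Real.log_le_log (by linarith) ?_
    rw [le_div_iff₀ h0]; nlinarith
  · have := Real.log_two_gt_d9
    have := Real.log_le_log (by norm_num) hn'
    linarith

lemma rate_pos {d n : ℕ} (hd : 1 ≤ d) (hn : 2 ≤ n) {δ₀ : ℝ} (h0 : 0 < δ₀) (h1 : δ₀ < 1) :
    0 < rate d n δ₀ := by
  obtain ⟨h2, h3⟩ := log_ratio_pos hn h0 h1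
  have hn' : (2 : ℝ) ≤ n := by exact_mod_cast hn
  have hd' : (1 : ℝ) ≤ d := by exact_mod_cast hd
  exact Real.sqrt_pos.2 (div_pos (mul_pos (by linarith) (by linarith)) (by linarith))

lemma measurableSet_uniform_deviation {X : Type*} [MeasurableSpace X] (P : Measure (X × Bool))
    (H : Finset (X → Bool)) (hm : ∀ h ∈ H, Measurable h) (n : ℕ) (c : ℝ) :
    MeasurableSet {D : Fin n → X × Bool | ∀ h ∈ H, |empErr h D - err P h| ≤ c} := by
  have : {D : Fin n → X × Bool | ∀ h ∈ H, |empErr h D - err P h| ≤ c}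
      = ⋂ h ∈ H, {D | |empErr h D - err P h| ≤ c} := by
    ext D; simp
  rw [this]
  refine Finset.measurableSet_biInter _ fun h hh => ?_
  have := measurable_empErr (n := n) (hm h hh)
  exact measurableSet_le (by fun_prop) measurable_const

/-- With `ε = 8ρ` the exponent `n ε² / 8` is `8 d log (n / δ₀)`, so the failure bound is at most `(4
(2n + 1) (δ₀ / n) ^ 8) ^ d ≤ δ₀ ^ d ≤ δ₀`. -/
lemma eight_mem_uniform_constants {X : Type*} [MeasurableSpace X] (P : Measure (X × Bool))
    [IsProbabilityMeasure P] (H : Finset (X → Bool)) (hm : ∀ h ∈ H, Measurable h) {d n : ℕ}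
    (hd : vcDim H ≤ d) (hd1 : 1 ≤ d) (hn : 2 ≤ n) {δ₀ : ℝ} (h0 : 0 < δ₀) (h1 : δ₀ < 1) :
    ENNReal.ofReal (1 - δ₀) ≤ (Measure.pi fun _ : Fin n => P)
      {D | ∀ h ∈ H, |empErr h D - err P h| ≤ 8 * rate d n δ₀} := by
  obtain ⟨hl1, hl2⟩ := log_ratio_pos hn h0 h1
  have hn' : (2 : ℝ) ≤ n := by exact_mod_cast hn
  have hd' : (1 : ℝ) ≤ d := by exact_mod_cast hd1
  have hnpos : (0 : ℝ) < n := by linarith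
  have hρ := rate_pos hd1 hn h0 h1
  have hsq : n * (8 * rate d n δ₀) ^ 2 = 64 * (d * Real.log (n / δ₀)) := by
    rw [mul_pow, rate, Real.sq_sqrt (by have := hl2.trans_le hl1; positivity)]
    field_simp; ring
  have hdl : 1 / 2 < d * Real.log (n / δ₀) := by nlinarith
  have hvc := measure_exists_deviation_le P H hm hd (n := n) (by omega) (8 * rate d n δ₀) (by positivity)
    (by rw [hsq]; linarith)
  have hbound : 4 * (2 * n + 1) ^ d * Real.exp (-(n * (8 * rate d n δ₀) ^ 2 / 8)) ≤ δ₀ := by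
    have e1 : Real.exp (-(n * (8 * rate d n δ₀) ^ 2 / 8)) = ((δ₀ / n) ^ 8) ^ d := by
      have : -(n * (8 * rate d n δ₀) ^ 2 / 8) = d * (8 * Real.log (δ₀ / n)) := by
        rw [hsq, Real.log_div (by positivity) (by positivity),
          Real.log_div (by positivity) (by positivity)]
        ring
      rw [this, Real.exp_nat_mul]
      congr 1
      have h8 : (8 : ℝ) = ((8 : ℕ) : ℝ) := by norm_num
      rw [h8, Real.exp_nat_mul, Real.exp_log (by positivity)]
    have e2 : (4 : ℝ) ≤ 4 ^ d := by
      simpa using pow_le_pow_right₀ (by norm_num : (1 : ℝ) ≤ 4) hd1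
    have e3 : 4 * (2 * n + 1) * (δ₀ / n) ^ 8 ≤ δ₀ := by
      rw [div_pow, mul_div_assoc', div_le_iff₀ (by positivity)]
      have k1 : 4 * (2 * (n : ℝ) + 1) ≤ (n : ℝ) ^ 8 := by
        have : (n : ℝ) ^ 8 = n * n ^ 7 := by ring
        have h7 : (2 : ℝ) ^ 7 ≤ n ^ 7 := pow_le_pow_left₀ (by norm_num) hn' 7
        rw [this]; nlinarith
      have k2 : δ₀ ^ 8 ≤ δ₀ := pow_le_of_le_one h0.le h1.le (by norm_num)
      calc 4 * (2 * (n : ℝ) + 1) * δ₀ ^ 8 ≤ (n : ℝ) ^ 8 * δ₀ :=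
            mul_le_mul k1 k2 (by positivity) (by positivity)
        _ = _ := mul_comm _ _
    calc 4 * (2 * n + 1) ^ d * Real.exp (-(n * (8 * rate d n δ₀) ^ 2 / 8))
        ≤ 4 ^ d * (2 * n + 1) ^ d * ((δ₀ / n) ^ 8) ^ d := by
          rw [e1]; gcongr
      _ = (4 * (2 * n + 1) * (δ₀ / n) ^ 8) ^ d := by rw [mul_pow, mul_pow]
      _ ≤ δ₀ ^ d := pow_le_pow_left₀ (by positivity) e3 d
      _ ≤ δ₀ := pow_le_of_le_one h0.le h1.le (by omega)
  have hcompl : {D : Fin n → X × Bool | ∀ h ∈ H, |empErr h D - err P h| ≤ 8 * rate d n δ₀}ᶜ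
      = {D | ∃ h ∈ H, 8 * rate d n δ₀ < |empErr h D - err P h|} := by
    ext D; simp
  have hmeas := measurableSet_uniform_deviation P H hm n (8 * rate d n δ₀)
  rw [← hcompl, prob_compl_eq_one_sub hmeas] at hvc
  have h5 := tsub_le_iff_right.1 (hvc.trans (ENNReal.ofReal_le_ofReal hbound))
  rw [ENNReal.ofReal_sub _ h0.le, ENNReal.ofReal_one]
  exact tsub_le_iff_left.2 h5

lemma ucConstant_le_eight {X : Type*} [MeasurableSpace X] (P : Measure (X × Bool))
    [IsProbabilityMeasure P] (H : Finset (X → Bool)) (hm : ∀ h ∈ H, Measurable h) {d n : ℕ}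
    (hd : vcDim H ≤ d) (hd1 : 1 ≤ d) (hn : 2 ≤ n) {δ₀ : ℝ} (h0 : 0 < δ₀) (h1 : δ₀ < 1) :
    ucConstant P H d n δ₀ ≤ 8 :=
  csInf_le ⟨0, fun _ hc => hc.1.le⟩
    ⟨by norm_num, eight_mem_uniform_constants P H hm hd hd1 hn h0 h1⟩

/-- The infimum in the definition of `ucConstant` satisfies the uniform deviation bound. -/
lemma le_measure_ucConstant {X : Type*} [MeasurableSpace X] (P : Measure (X × Bool))
    [IsProbabilityMeasure P] (H : Finset (X → Bool)) (hm : ∀ h ∈ H, Measurable h) {d n : ℕ}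
    (hd : vcDim H ≤ d) (hd1 : 1 ≤ d) (hn : 2 ≤ n) {δ₀ : ℝ} (h0 : 0 < δ₀) (h1 : δ₀ < 1) :
    ENNReal.ofReal (1 - δ₀) ≤ (Measure.pi fun _ : Fin n => P)
      {D | ∀ h ∈ H, |empErr h D - err P h| ≤ ucConstant P H d n δ₀ * rate d n δ₀} := by
  set μ := Measure.pi fun _ : Fin n => P with hμ
  set c₀ := ucConstant P H d n δ₀ with hc₀
  have hρ := rate_pos hd1 hn h0 h1
  -- The events for `c₀ + 1 / (k + 1)` decrease to the event for `c₀`; continuity from above carries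
  -- the bound to the limit.
  set E : ℕ → Set (Fin n → X × Bool) := fun k =>
    {D | ∀ h ∈ H, |empErr h D - err P h| ≤ (c₀ + 1 / ((k : ℝ) + 1)) * rate d n δ₀} with hE
  have hEk : ∀ k, ENNReal.ofReal (1 - δ₀) ≤ μ (E k) := by
    intro k
    have hlt : c₀ < c₀ + 1 / ((k : ℝ) + 1) := by
      have : (0 : ℝ) < 1 / ((k : ℝ) + 1) := by positivity
      linarith
    rw [hc₀, ucConstant] at hlt
    obtain ⟨c, ⟨-, hc⟩, hck⟩ := exists_lt_of_csInf_lt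
      (by exact ⟨8, by norm_num, eight_mem_uniform_constants P H hm hd hd1 hn h0 h1⟩) hlt
    refine hc.trans (measure_mono fun D hD h hh => (hD h hh).trans ?_)
    exact mul_le_mul_of_nonneg_right hck.le hρ.le
  have hanti : Antitone E := by
    intro k l hkl D hD h hh
    refine (hD h hh).trans (mul_le_mul_of_nonneg_right ?_ hρ.le)
    gcongr
  have hlim := tendsto_measure_iInter_atTop (μ := μ) (s := E)
    (fun k : ℕ => (measurableSet_uniform_deviation P H hm n
      ((c₀ + 1 / ((k : ℝ) + 1)) * rate d n δ₀)).nullMeasurableSet) hanti ⟨0, measure_ne_top _ _⟩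
  refine (ge_of_tendsto' hlim hEk).trans (measure_mono ?_)
  intro D hD h hh
  have h2 : Filter.Tendsto (fun k : ℕ => (c₀ + 1 / ((k : ℝ) + 1)) * rate d n δ₀) Filter.atTop
      (nhds ((c₀ + 0) * rate d n δ₀)) :=
    (tendsto_const_nhds.add tendsto_one_div_add_atTop_nhds_zero_nat).mul_const _
  rw [add_zero] at h2
  exact ge_of_tendsto' h2 fun k => Set.mem_iInter.1 hD k h hh

/-! ### Tails of the Laplace distribution -/

lemma laplace_apply_of_eqOn {b : ℝ} {s : Set ℝ} (hs : MeasurableSet s) {g : ℝ → ℝ}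
    (hg : ∀ x ∈ s, Real.exp (-|x| / b) = g x) (hb : 0 < b) (hint : IntegrableOn g s) :
    laplace b s = ENNReal.ofReal ((2 * b)⁻¹ * ∫ x in s, g x) := by
  have hnn : ∀ x ∈ s, 0 ≤ (2 * b)⁻¹ * g x := fun x hx => by
    rw [← hg x hx]; positivity
  rw [laplace, withDensity_apply _ hs, ← integral_const_mul,
    ofReal_integral_eq_lintegral_ofReal (hint.const_mul _)
      ((ae_restrict_iff' hs).2 (Filter.Eventually.of_forall hnn))]
  exact setLIntegral_congr_fun hs fun x hx => by simp only [hg x hx]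

lemma laplace_Ioi {b s : ℝ} (hb : 0 < b) (hs : 0 ≤ s) :
    laplace b (Set.Ioi s) = ENNReal.ofReal (Real.exp (-(s / b)) / 2) := by
  have hb' : -b⁻¹ < 0 := neg_neg_of_pos (inv_pos.2 hb)
  rw [laplace_apply_of_eqOn measurableSet_Ioi (g := fun x => Real.exp (-b⁻¹ * x)) ?_ hb
    (integrableOn_exp_mul_Ioi hb' s), integral_exp_mul_Ioi hb' s]
  · congr 1
    have : -b⁻¹ * s = -(s / b) := by ring
    rw [this]; field_simp
  · intro x hx
    rw [abs_of_pos (hs.trans_lt hx)]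
    congr 1; ring

lemma laplace_Iio_neg {b s : ℝ} (hb : 0 < b) (hs : 0 ≤ s) :
    laplace b (Set.Iio (-s)) = ENNReal.ofReal (Real.exp (-(s / b)) / 2) := by
  have hb' : 0 < b⁻¹ := inv_pos.2 hb
  rw [laplace_apply_of_eqOn measurableSet_Iio (g := fun x => Real.exp (b⁻¹ * x)) ?_ hb
    ((integrableOn_exp_mul_Iic hb' (-s)).mono_set Set.Iio_subset_Iic_self),
    ← integral_Iic_eq_integral_Iio, integral_exp_mul_Iic hb' (-s)]
  · congr 1
    have : b⁻¹ * -s = -(s / b) := by ring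
    rw [this]; field_simp
  · intro x hx
    rw [abs_of_neg ((Set.mem_Iio.1 hx).trans_le (by linarith))]
    congr 1; ring

lemma isProbabilityMeasure_laplace {b : ℝ} (hb : 0 < b) : IsProbabilityMeasure (laplace b) := by
  constructor
  have h0 : laplace b {0} = 0 := by
    rw [laplace]
    exact withDensity_absolutelyContinuous _ _ (by simp)
  have h1 := laplace_Ioi hb le_rfl
  have h2 := laplace_Iio_neg hb le_rfl
  rw [neg_zero] at h2
  have h3 : (Set.univ : Set ℝ) = (Set.Iio 0 ∪ {0}) ∪ Set.Ioi 0 := by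
    ext x
    simp only [Set.mem_univ, Set.mem_union, Set.mem_Iio, Set.mem_singleton_iff, Set.mem_Ioi, true_iff]
    rcases lt_trichotomy x 0 with h | h | h <;> tauto
  rw [h3, measure_union _ measurableSet_Ioi, measure_union _ (measurableSet_singleton 0), h0, h1, h2]
  · rw [add_zero, ← ENNReal.ofReal_add (by positivity) (by positivity)]
    norm_num
  · simp
  · rw [Set.disjoint_left]
    rintro x (hx | hx) hx'
    · exact lt_asymm (Set.mem_Iio.1 hx) (Set.mem_Ioi.1 hx')
    · exact (ne_of_gt (Set.mem_Ioi.1 hx')) hx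

lemma laplace_Iic {b s : ℝ} (hb : 0 < b) (hs : 0 ≤ s) :
    laplace b (Set.Iic s) = ENNReal.ofReal (1 - Real.exp (-(s / b)) / 2) := by
  have := isProbabilityMeasure_laplace hb
  rw [← Set.compl_Ioi, prob_compl_eq_one_sub measurableSet_Ioi, laplace_Ioi hb hs,
    ENNReal.ofReal_sub _ (by positivity), ENNReal.ofReal_one]

lemma laplace_Ici_neg {b s : ℝ} (hb : 0 < b) (hs : 0 ≤ s) :
    laplace b (Set.Ici (-s)) = ENNReal.ofReal (1 - Real.exp (-(s / b)) / 2) := by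
  have := isProbabilityMeasure_laplace hb
  rw [← Set.compl_Iio, prob_compl_eq_one_sub measurableSet_Iio, laplace_Iio_neg hb hs,
    ENNReal.ofReal_sub _ (by positivity), ENNReal.ofReal_one]

/-- Bounding the stopping rank from above needs only one passing test, so a single `Z_r` is
constrained and no union bound over ranks occurs. -/
lemma lmmNoise_rectangle {α : ℝ} (hα : 0 < α) {K : ℕ} (r : Fin (K - 1)) (s₁ s₂ s₃ : Set ℝ)
    (h₃ : MeasurableSet s₃) :
    lmmNoise α K (s₁ ×ˢ (s₂ ×ˢ {Zs | Zs r ∈ s₃}))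
      = laplace (3 / α) s₁ * (laplace (6 / α) s₂ * laplace (12 / α) s₃) := by
  have i1 := isProbabilityMeasure_laplace (b := 3 / α) (by positivity)
  have i2 := isProbabilityMeasure_laplace (b := 6 / α) (by positivity)
  have i3 := isProbabilityMeasure_laplace (b := 12 / α) (by positivity)
  have h4 : (Measure.pi fun _ : Fin (K - 1) => laplace (12 / α)) {Zs | Zs r ∈ s₃}
      = laplace (12 / α) s₃ :=
    (measurePreserving_eval (fun _ : Fin (K - 1) => laplace (12 / α)) r).measure_preimage
      h₃.nullMeasurableSet
  rw [lmmNoise, Measure.prod_prod, Measure.prod_prod, h4]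

lemma isProbabilityMeasure_lmmNoise {α : ℝ} (hα : 0 < α) (K : ℕ) :
    IsProbabilityMeasure (lmmNoise α K) := by
  have i1 := isProbabilityMeasure_laplace (b := 3 / α) (by positivity)
  have i2 := isProbabilityMeasure_laplace (b := 6 / α) (by positivity)
  have i3 := isProbabilityMeasure_laplace (b := 12 / α) (by positivity)
  unfold lmmNoise
  infer_instance

/-! ### Order statistics and the stopping rank -/

section Rank

variable {ι : Type*} {H : Finset ι} {f : ι → ℝ}

lemma bddAbove_kthHighest {ℓ : ℕ} (hℓ : 1 ≤ ℓ) :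
    BddAbove {v : ℝ | ℓ ≤ (H.filter fun i => v ≤ f i).card} := by
  refine ⟨∑ i ∈ H, |f i|, fun v hv => ?_⟩
  obtain ⟨i, hi⟩ := Finset.card_pos.1 (hℓ.trans hv)
  obtain ⟨hiH, hvi⟩ := Finset.mem_filter.1 hi
  exact hvi.trans ((le_abs_self _).trans
    (Finset.single_le_sum (f := fun i => |f i|) (fun _ _ => abs_nonneg _) hiH))

lemma le_kthHighest_one {i : ι} (hi : i ∈ H) : f i ≤ kthHighest H f 1 :=
  le_csSup (bddAbove_kthHighest le_rfl)
    (Finset.card_pos.2 ⟨i, Finset.mem_filter.2 ⟨hi, le_rfl⟩⟩)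

/-- If all items outside a set of fewer than `ℓ` items have value at most `v`, then so has the
`ℓ`-th highest item. -/
lemma kthHighest_le {ℓ : ℕ} (hℓ : ℓ ≤ H.card) {T : Finset ι} (hT : T.card < ℓ) {v : ℝ}
    (hv : ∀ i ∈ H, i ∉ T → f i ≤ v) : kthHighest H f ℓ ≤ v := by
  -- The witness lies below every value of `f` on `H`; it shows that the supremum is over a nonempty
  -- set.
  refine csSup_le ⟨-∑ i ∈ H, |f i|, ?_⟩ fun u hu => ?_
  · have : (H.filter fun i => -∑ i ∈ H, |f i| ≤ f i) = H := by
      refine Finset.filter_true_of_mem fun i hi => ?_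
      have := Finset.single_le_sum (f := fun i => |f i|) (fun _ _ => abs_nonneg _) hi
      have := neg_abs_le (f i)
      linarith
    simpa [this] using hℓ
  · obtain ⟨i, hi, hiT⟩ := Finset.exists_mem_notMem_of_card_lt_card (hT.trans_le hu)
    obtain ⟨hiH, hui⟩ := Finset.mem_filter.1 hi
    exact hui.trans (hv i hiH hiT)

variable {n : ℕ} {α δ Z G : ℝ} {Zs : Fin (H.card - 1) → ℝ}

lemma lmmRank_le_card : lmmRank n α δ H f Z G Zs ≤ H.card :=
  Nat.sInf_le (Or.inl rfl)

lemma one_le_lmmRank (hH : H.Nonempty) : 1 ≤ lmmRank n α δ H f Z G Zs := by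
  refine le_csInf ⟨H.card, Or.inl rfl⟩ ?_
  rintro ℓ (hℓ | ⟨r, hr, -⟩)
  · rw [Set.mem_singleton_iff.1 hℓ]; exact hH.card_pos
  · omega

/-- Indices shift by one: `Zs r` is the noise of the test at rank `r + 1`, which looks at the value
of rank `r + 2`. -/
lemma lmmRank_le_of_test (r : Fin (H.card - 1))
    (hr : (Zs r + G) / n + bigThreshold n α δ (r + 1) <
      (kthHighest H f 1 + Z / n) - kthHighest H f (r + 1 + 1)) :
    lmmRank n α δ H f Z G Zs ≤ r + 1 :=
  Nat.sInf_le (Or.inr ⟨r, rfl, hr⟩)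

end Rank

/-! ### The exponential mechanism on a top set -/

lemma IsTopSet.exists_max {ι : Type*} {H U : Finset ι} {f : ι → ℝ} {ℓ : ℕ}
    (hU : IsTopSet H f ℓ U) (hℓ : 1 ≤ ℓ) : ∃ i ∈ U, ∀ j ∈ H, f j ≤ f i := by
  classical
  have hne : U.Nonempty := Finset.card_pos.1 (by rw [hU.2.1]; exact hℓ)
  obtain ⟨i, hi, hmax⟩ := Finset.exists_max_image U f hne
  exact ⟨i, hi, fun j hj => if hjU : j ∈ U then hmax j hjU else hU.2.2 i hi j hj hjU⟩

open scoped Classical in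
lemma one_sub_le_sum_expMech {ι : Type*} {H U : Finset ι} {f : ι → ℝ} {β : ℝ} (hUH : U ⊆ H)
    (hU : U.Nonempty) (S : Set ι) :
    ENNReal.ofReal (1 - ∑ i ∈ U.filter (· ∉ S),
        Real.exp (β * f i) / ∑ j ∈ U, Real.exp (β * f j)) ≤
      ∑ i ∈ H, S.indicator (fun i => ENNReal.ofReal (expMech β f U i)) i := by
  set W := ∑ j ∈ U, Real.exp (β * f j) with hW
  have hWpos : 0 < W := Finset.sum_pos (fun _ _ => Real.exp_pos _) hU
  have hmech : ∀ i ∈ U, expMech β f U i = Real.exp (β * f i) / W := fun i hi => by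
    simp [expMech, hi, hW]
  have h1 : ∑ i ∈ U.filter (· ∈ S), ENNReal.ofReal (Real.exp (β * f i) / W) ≤
      ∑ i ∈ H, S.indicator (fun i => ENNReal.ofReal (expMech β f U i)) i := by
    refine le_trans (le_of_eq ?_)
      (Finset.sum_le_sum_of_subset ((Finset.filter_subset (· ∈ S) U).trans hUH))
    refine Finset.sum_congr rfl fun i hi => ?_
    obtain ⟨hiU, hiS⟩ := Finset.mem_filter.1 hi
    rw [Set.indicator_of_mem hiS, hmech i hiU]
  refine le_trans ?_ h1
  rw [← ENNReal.ofReal_sum_of_nonneg fun i _ => by positivity]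
  refine ENNReal.ofReal_le_ofReal ?_
  have h2 : ∑ i ∈ U.filter (· ∈ S), Real.exp (β * f i) / W
      + ∑ i ∈ U.filter (· ∉ S), Real.exp (β * f i) / W = 1 := by
    rw [Finset.sum_filter_add_sum_filter_not, ← Finset.sum_div, ← hW, div_self hWpos.ne']
  linarith

lemma one_le_sum_expMech {ι : Type*} {H U : Finset ι} {f : ι → ℝ} {β : ℝ} (hUH : U ⊆ H)
    (hU : U.Nonempty) (S : Set ι) (hS : ∀ i ∈ U, i ∈ S) :
    1 ≤ ∑ i ∈ H, S.indicator (fun i => ENNReal.ofReal (expMech β f U i)) i := by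
  classical
  have h := one_sub_le_sum_expMech (f := f) (β := β) hUH hU S
  rw [Finset.filter_false_of_mem fun i hi => not_not.2 (hS i hi)] at h
  simpa using h

/-- The exponential mechanism returns a nearly optimal item. -/
lemma expMech_success {ι : Type*} {H U : Finset ι} {f : ι → ℝ} {β s : ℝ} (hβ : 0 ≤ β)
    (hUH : U ⊆ H) {i₀ : ι} (hi₀ : i₀ ∈ U) (S : Set ι)
    (hS : ∀ i ∈ U, f i₀ - s ≤ f i → i ∈ S) :
    ENNReal.ofReal (1 - U.card * Real.exp (-(β * s))) ≤
      ∑ i ∈ H, S.indicator (fun i => ENNReal.ofReal (expMech β f U i)) i := by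
  classical
  refine le_trans (ENNReal.ofReal_le_ofReal ?_)
    (one_sub_le_sum_expMech (f := f) (β := β) hUH ⟨i₀, hi₀⟩ S)
  set W := ∑ j ∈ U, Real.exp (β * f j) with hW
  have hWpos : 0 < W := Finset.sum_pos (fun _ _ => Real.exp_pos _) ⟨i₀, hi₀⟩
  have h3 : ∑ i ∈ U.filter (· ∉ S), Real.exp (β * f i) / W
      ≤ U.card * Real.exp (-(β * s)) := by
    -- An item outside `S` scores more than `s` below `i₀`, while the normalizer is at least the
    -- weight of `i₀`.
    have h4 : ∀ i ∈ U.filter (· ∉ S), Real.exp (β * f i) / W ≤ Real.exp (-(β * s)) := by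
      intro i hi
      obtain ⟨hiU, hiS⟩ := Finset.mem_filter.1 hi
      have h5 : f i < f i₀ - s := not_le.1 fun h => hiS (hS i hiU h)
      have h6 : Real.exp (β * f i₀) ≤ W :=
        Finset.single_le_sum (f := fun j => Real.exp (β * f j))
          (fun _ _ => (Real.exp_pos _).le) hi₀
      rw [div_le_iff₀ hWpos]
      calc Real.exp (β * f i) ≤ Real.exp (-(β * s) + β * f i₀) :=
            Real.exp_le_exp.2 (by nlinarith)
        _ = Real.exp (-(β * s)) * Real.exp (β * f i₀) := Real.exp_add _ _
        _ ≤ _ := mul_le_mul_of_nonneg_left h6 (Real.exp_pos _).le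
    refine (Finset.sum_le_card_nsmul _ _ _ h4).trans ?_
    rw [nsmul_eq_mul]
    refine mul_le_mul_of_nonneg_right ?_ (Real.exp_pos _).le
    exact_mod_cast Finset.card_filter_le _ _
  linarith

/-- The integral is restricted to `W`. Only `W` has to be measurable, so measurability of the
stopping rank never enters. -/
lemma mul_le_lmmProb {ι : Type*} {n : ℕ} {α δ : ℝ} {H : Finset ι} {f : ι → ℝ}
    {top : ℕ → Finset ι} {S : Set ι} {W : Set (ℝ × ℝ × (Fin (H.card - 1) → ℝ))}
    (hW : MeasurableSet W) {p q : ℝ≥0∞} (hp : p ≤ lmmNoise α H.card W)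
    (hq : ∀ w ∈ W, q ≤ ∑ i ∈ H, S.indicator (fun i => ENNReal.ofReal
      (expMech (n * α / 6) f (top (lmmRank n α δ H f w.1 w.2.1 w.2.2)) i)) i) :
    q * p ≤ lmmProb n α δ H f top S := by
  refine (mul_le_mul_right hp q).trans ?_
  rw [← setLIntegral_const]
  exact (setLIntegral_mono' hW hq).trans (setLIntegral_le_lintegral _ _)

/-- If every outcome of the noise in `W` ends the loop at a rank at most `m`, the mechanism returns
a nearly optimal item. -/
lemma lmmProb_success {ι : Type*} {n : ℕ} {α δ : ℝ} (hα : 0 ≤ α) {H : Finset ι} (hH : H.Nonempty)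
    {f : ι → ℝ} {top : ℕ → Finset ι} (htop : ∀ ℓ ∈ Finset.Icc 1 H.card, IsTopSet H f ℓ (top ℓ))
    {S : Set ι} {W : Set (ℝ × ℝ × (Fin (H.card - 1) → ℝ))} (hW : MeasurableSet W) {p : ℝ≥0∞}
    (hp : p ≤ lmmNoise α H.card W) {m : ℕ}
    (hm : ∀ w ∈ W, lmmRank n α δ H f w.1 w.2.1 w.2.2 ≤ m) {s : ℝ}
    (hS : ∀ i ∈ H, (∀ j ∈ H, f j - s ≤ f i) → i ∈ S) :
    ENNReal.ofReal (1 - m * Real.exp (-(n * α / 6 * s))) * p ≤ lmmProb n α δ H f top S := by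
  refine mul_le_lmmProb hW hp fun w hw => ?_
  have h1 := one_le_lmmRank (n := n) (α := α) (δ := δ) (f := f) (Z := w.1) (G := w.2.1)
    (Zs := w.2.2) hH
  have hU := htop _ (Finset.mem_Icc.2 ⟨h1, lmmRank_le_card⟩)
  obtain ⟨i₀, hi₀, hmax⟩ := hU.exists_max h1
  refine le_trans (ENNReal.ofReal_le_ofReal ?_) (expMech_success (β := n * α / 6) (s := s)
    (by positivity) hU.1 hi₀ S fun i hi hle => hS i (hU.1 hi) fun j hj => ?_)
  · have : ((top (lmmRank n α δ H f w.1 w.2.1 w.2.2)).card : ℝ) ≤ m := by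
      rw [hU.2.1]; exact_mod_cast hm w hw
    have := mul_le_mul_of_nonneg_right this (Real.exp_pos (-(n * α / 6 * s))).le
    linarith
  · linarith [hmax j hj]

/-! ### Success probability of the large margin mechanism -/

lemma bigThreshold_le {n m : ℕ} (hn : 0 < n) (hm : 1 ≤ m) {α δ : ℝ} (hα : 0 < α) (hα1 : α < 1)
    (hδ : 0 < δ) (hδ1 : δ < 1) :
    bigThreshold n α δ m ≤ (39 * Real.log (3 * m / δ) + 6) / (n * α) := by
  have hn' : (0 : ℝ) < n := by exact_mod_cast hn
  have hm' : (1 : ℝ) ≤ m := by exact_mod_cast hm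
  set Λ := Real.log (3 * m / δ) with hΛ
  have l1 : Real.log (3 / (2 * δ)) ≤ Λ := by
    refine Real.log_le_log (by positivity) ?_
    rw [div_le_div_iff₀ (by positivity) hδ]; nlinarith
  have l2 : Real.log (3 / δ) ≤ Λ := by
    refine Real.log_le_log (by positivity) ?_
    gcongr; linarith
  have l3 : Real.log (3 * m * (m + 1) / δ) ≤ 2 * Λ := by
    have : 2 * Λ = Real.log ((3 * m / δ) ^ 2) := by rw [Real.log_pow, hΛ]; norm_num
    rw [this]
    refine Real.log_le_log (by positivity) ?_
    rw [div_pow, div_le_div_iff₀ hδ (by positivity)]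
    have h1 : (m + 1) * δ ≤ 3 * m := by nlinarith
    have h2 := mul_le_mul_of_nonneg_left h1 (by positivity : 0 ≤ 3 * m * δ)
    nlinarith
  have hpos : (0 : ℝ) < n * α := by positivity
  -- The coefficient of `Λ` becomes `3 + 6 + 2 * 12 + 6 = 39`, and the remaining `6 * α` is at most
  -- `6`.
  have e : bigThreshold n α δ m = (3 * Real.log (3 / (2 * δ)) + 6 * Real.log (3 / δ)
      + 12 * Real.log (3 * m * (m + 1) / δ) + 6 * (α + Λ)) / (n * α) := by
    unfold bigThreshold tThreshold
    rw [← hΛ]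
    field_simp
  rw [e]
  exact div_le_div_of_nonneg_right (by linarith) hpos.le

/-- For `δ` close to `1` it suffices that the loop ends at rank one with constant probability. -/
lemma lmmProb_of_half_le {ι : Type*} {n : ℕ} (hn : 0 < n) {α δ : ℝ} (hα : 0 < α) (hα1 : α < 1)
    (hδ : 1 / 2 ≤ δ) (hδ1 : δ < 1) {H : Finset ι} (hH : H.Nonempty) {f : ι → ℝ}
    {top : ℕ → Finset ι} (htop : ∀ ℓ ∈ Finset.Icc 1 H.card, IsTopSet H f ℓ (top ℓ)) {S : Set ι}
    (hS : ∀ i ∈ H, (∀ j ∈ H, f j ≤ f i) → i ∈ S) :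
    ENNReal.ofReal (Real.exp (-70) / 8) ≤ lmmProb n α δ H f top S := by
  have hn' : (0 : ℝ) < n := by exact_mod_cast hn
  have hprob := isProbabilityMeasure_lmmNoise hα H.card
  have hW : ∃ W : Set (ℝ × ℝ × (Fin (H.card - 1) → ℝ)), MeasurableSet W ∧
      ENNReal.ofReal (Real.exp (-70) / 8) ≤ lmmNoise α H.card W ∧
      ∀ w ∈ W, lmmRank n α δ H f w.1 w.2.1 w.2.2 ≤ 1 := by
    by_cases hK : H.card ≤ 1
    · refine ⟨Set.univ, MeasurableSet.univ, ?_, fun w _ => lmmRank_le_card.trans hK⟩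
      rw [measure_univ]
      refine ENNReal.ofReal_le_one.2 ?_
      have : Real.exp (-70) ≤ 1 := Real.exp_le_one_iff.2 (by norm_num)
      linarith
    · set r : Fin (H.card - 1) := ⟨0, by omega⟩ with hr
      -- For `δ ≥ 1/2` the threshold at rank one is at most `(39 * 5 + 6) / (n α) = 201 / (n α)`, so
      -- `Z > 210 / α` passes the test even without a gap. The probability is `exp (-70) / 2` times
      -- two factors `1/2`.
      refine ⟨Set.Ioi (210 / α) ×ˢ (Set.Iic 0 ×ˢ {Zs | Zs r ∈ Set.Iic 0}), ?_, ?_, ?_⟩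
      · exact measurableSet_Ioi.prod (measurableSet_Iic.prod
          (measurable_pi_apply r measurableSet_Iic))
      · rw [lmmNoise_rectangle hα r _ _ _ measurableSet_Iic,
          laplace_Ioi (by positivity) (by positivity), laplace_Iic (by positivity) le_rfl,
          laplace_Iic (by positivity) le_rfl, ← ENNReal.ofReal_mul (by norm_num),
          ← ENNReal.ofReal_mul (by positivity)]
        refine ENNReal.ofReal_le_ofReal (le_of_eq ?_)
        have : 210 / α / (3 / α) = 70 := by field_simp; norm_num
        rw [this]
        simp only [zero_div, neg_zero, Real.exp_zero]
        ring
      · rintro w ⟨hZ, hG, hZs⟩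
        refine lmmRank_le_of_test r ?_
        have hZ' : 210 / α < w.1 := hZ
        have hG' : w.2.1 ≤ 0 := hG
        have hZs' : w.2.2 r ≤ 0 := hZs
        have h1 : kthHighest H f (0 + 1 + 1) ≤ kthHighest H f 1 :=
          kthHighest_le (T := ∅) (by omega) (by simp) fun i hi _ => le_kthHighest_one hi
        have h2 := bigThreshold_le (δ := δ) hn le_rfl hα hα1 (by linarith) hδ1
        have h3 : Real.log (3 * (1 : ℕ) / δ) ≤ 5 := by
          have : 3 * ((1 : ℕ) : ℝ) / δ ≤ 6 := by
            rw [div_le_iff₀ (by linarith)]; push_cast; linarith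
          have := Real.log_le_sub_one_of_pos
            (x := 3 * ((1 : ℕ) : ℝ) / δ) (div_pos (by norm_num) (by linarith))
          linarith
        have h4 : (w.2.2 r + w.2.1) / n ≤ 0 := div_nonpos_of_nonpos_of_nonneg (by linarith) hn'.le
        have h5 : (39 * Real.log (3 * (1 : ℕ) / δ) + 6) / (n * α) ≤ 210 / α / n := by
          rw [div_div, mul_comm α]
          exact div_le_div_of_nonneg_right (by linarith) (by positivity)
        have h6 : 210 / α / n < w.1 / n := div_lt_div_of_pos_right hZ' hn'
        have e : ((r : ℕ) + 1) = 1 := rfl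
        rw [e]
        linarith
  obtain ⟨W, hWm, hWp, hWr⟩ := hW
  rw [← one_mul (ENNReal.ofReal _)]
  refine mul_le_lmmProb hWm hWp fun w hw => ?_
  have h1 := one_le_lmmRank (n := n) (α := α) (δ := δ) (f := f) (Z := w.1) (G := w.2.1)
    (Zs := w.2.2) hH
  have hU := htop _ (Finset.mem_Icc.2 ⟨h1, lmmRank_le_card⟩)
  obtain ⟨i₀, hi₀, hmax⟩ := hU.exists_max h1
  refine one_le_sum_expMech hU.1 ⟨i₀, hi₀⟩ S fun i hi => ?_
  have hle := Finset.card_le_one.1 (hU.2.1.le.trans (hWr w hw)) i hi i₀ hi₀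
  exact hS i (hU.1 hi) (by rwa [hle])

/-- If the `(m+1)`-st highest value lies well below the highest one, the mechanism behaves like the
exponential mechanism on at most `m` items. -/
lemma lmmProb_of_margin {ι : Type*} {n : ℕ} (hn : 0 < n) {α δ : ℝ} (hα : 0 < α) (hα1 : α < 1)
    (hδ : 0 < δ) (hδ1 : δ < 1) {H : Finset ι} (hH : H.Nonempty) {f : ι → ℝ}
    {top : ℕ → Finset ι} (htop : ∀ ℓ ∈ Finset.Icc 1 H.card, IsTopSet H f ℓ (top ℓ)) {S : Set ι}
    {m : ℕ} (hm : 1 ≤ m) {g : ℝ} (hg : 60 * Real.log (3 * m / δ) + 6 < n * α * g)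
    (hmargin : m < H.card → kthHighest H f (m + 1) ≤ kthHighest H f 1 - g)
    (hS : ∀ i ∈ H, (∀ j ∈ H, f j - 6 / (n * α) * Real.log (2 * m / δ) ≤ f i) → i ∈ S) :
    ENNReal.ofReal (1 - δ) ≤ lmmProb n α δ H f top S := by
  have hn' : (0 : ℝ) < n := by exact_mod_cast hn
  have hm' : (1 : ℝ) ≤ m := by exact_mod_cast hm
  have hprob := isProbabilityMeasure_lmmNoise hα H.card
  have hW : ∃ W : Set (ℝ × ℝ × (Fin (H.card - 1) → ℝ)), MeasurableSet W ∧
      ENNReal.ofReal (1 - δ / 2) ≤ lmmNoise α H.card W ∧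
      ∀ w ∈ W, lmmRank n α δ H f w.1 w.2.1 w.2.2 ≤ m := by
    by_cases hK : H.card ≤ m
    · refine ⟨Set.univ, MeasurableSet.univ, ?_, fun w _ => lmmRank_le_card.trans hK⟩
      rw [measure_univ]
      exact ENNReal.ofReal_le_one.2 (by linarith)
    · set r : Fin (H.card - 1) := ⟨m - 1, by omega⟩ with hr
      have hr1 : (r : ℕ) + 1 = m := by simp only [hr]; omega
      set L := Real.log (3 / δ) with hL
      have hL0 : 0 ≤ L := Real.log_nonneg (by rw [le_div_iff₀ hδ]; linarith)
      have hexp : Real.exp (-L) = δ / 3 := by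
        rw [Real.exp_neg, hL, Real.exp_log (by positivity), inv_div]
      -- Each variable is cut at `L` times its scale, a one-sided tail of mass `δ / 6`; the three
      -- together cost at most `δ / 2`. The noise contributes `3 + 6 + 12 = 21` multiples of `L`,
      -- and `21 + 39` is the `60` in `hg`.
      refine ⟨Set.Ici (-(3 / α * L)) ×ˢ (Set.Iic (6 / α * L) ×ˢ
        {Zs | Zs r ∈ Set.Iic (12 / α * L)}), ?_, ?_, ?_⟩
      · exact measurableSet_Ici.prod (measurableSet_Iic.prod
          (measurable_pi_apply r measurableSet_Iic))
      · have hq : ∀ b : ℝ, 0 < b → Real.exp (-(b * L / b)) = δ / 3 := fun b hb => by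
          rw [mul_div_cancel_left₀ _ hb.ne', hexp]
        rw [lmmNoise_rectangle hα r _ _ _ measurableSet_Iic,
          laplace_Ici_neg (by positivity) (by positivity),
          laplace_Iic (by positivity) (by positivity),
          laplace_Iic (by positivity) (by positivity), hq _ (by positivity), hq _ (by positivity),
          hq _ (by positivity), ← ENNReal.ofReal_mul (by linarith),
          ← ENNReal.ofReal_mul (by linarith)]
        refine ENNReal.ofReal_le_ofReal ?_
        have : (1 - δ / 3 / 2) * ((1 - δ / 3 / 2) * (1 - δ / 3 / 2))
            = 1 - δ / 2 + δ ^ 2 / 12 * (1 - δ / 18) := by ring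
        rw [this]
        have : 0 ≤ δ ^ 2 / 12 * (1 - δ / 18) := mul_nonneg (by positivity) (by linarith)
        linarith
      · rintro w ⟨hZ, hG, hZs⟩
        rw [← hr1]
        refine lmmRank_le_of_test r ?_
        rw [hr1]
        have hZ' : -(3 / α * L) ≤ w.1 := hZ
        have hG' : w.2.1 ≤ 6 / α * L := hG
        have hZs' : w.2.2 r ≤ 12 / α * L := hZs
        have h1 := hmargin (by omega)
        have h2 := bigThreshold_le (δ := δ) hn hm hα hα1 hδ hδ1
        have h3 : L ≤ Real.log (3 * m / δ) := by
          refine Real.log_le_log (by positivity) ?_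
          gcongr; linarith
        set Λ := Real.log (3 * m / δ) with hΛ
        have h4 : (w.2.2 r + w.2.1 - w.1) / n ≤ 21 * Λ / (n * α) := by
          rw [div_le_div_iff₀ hn' (by positivity)]
          have : w.2.2 r + w.2.1 - w.1 ≤ 21 / α * L := by
            have : 21 / α * L = 12 / α * L + 6 / α * L + 3 / α * L := by ring
            linarith
          have h6 : (w.2.2 r + w.2.1 - w.1) * α ≤ 21 * Λ := by
            have := mul_le_mul_of_nonneg_right this hα.le
            have e : 21 / α * L * α = 21 * L := by field_simp
            linarith
          have := mul_le_mul_of_nonneg_left h6 hn'.le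
          linarith
        have h5 : 21 * Λ / (n * α) + (39 * Λ + 6) / (n * α) < g := by
          rw [← add_div, div_lt_iff₀ (by positivity)]
          linarith
        have e : (w.2.2 r + w.2.1 - w.1) / n = (w.2.2 r + w.2.1) / n - w.1 / n := by ring
        linarith
  obtain ⟨W, hWm, hWp, hWr⟩ := hW
  refine le_trans ?_ (lmmProb_success (s := 6 / (n * α) * Real.log (2 * m / δ)) hα.le hH htop
    hWm hWp hWr hS)
  -- The slack is chosen so that the exponential mechanism fails with the other `δ / 2`.
  have e : m * Real.exp (-(n * α / 6 * (6 / (n * α) * Real.log (2 * m / δ)))) = δ / 2 := by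
    have : n * α / 6 * (6 / (n * α) * Real.log (2 * m / δ)) = Real.log (2 * m / δ) := by
      field_simp
    rw [this, Real.exp_neg, Real.exp_log (by positivity)]
    field_simp
  rw [e, ← ENNReal.ofReal_mul (by linarith)]
  exact ENNReal.ofReal_le_ofReal (by nlinarith)

/-! ### Shells -/

section Learning

variable {X : Type*} [MeasurableSpace X] {P : Measure (X × Bool)} {H : Finset (X → Bool)}
  {hH : H.Nonempty} {d n : ℕ} {α δ δ₀ C₀ C : ℝ}

lemma err_le_of_near_optimal {D : Fin n → X × Bool} {c s : ℝ}
    (hD : ∀ h ∈ H, |empErr h D - err P h| ≤ c) {h : X → Bool} (hh : h ∈ H)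
    (hopt : ∀ j ∈ H, (1 - empErr j D) - s ≤ 1 - empErr h D) :
    err P h ≤ minErr P H hH + 2 * c + s := by
  obtain ⟨h₁, hh₁, he⟩ := Finset.exists_mem_eq_inf' hH (err P)
  have e : minErr P H hH = err P h₁ := he
  have h1 := abs_le.1 (hD h hh)
  have h2 := abs_le.1 (hD h₁ hh₁)
  have h3 := hopt h₁ hh₁
  linarith

lemma one_le_card_shell (hC₀ : 0 ≤ C₀) (t : ℕ) :
    1 ≤ (shell P H hH d n δ₀ C₀ t).card := by
  obtain ⟨h₁, hh₁, he⟩ := Finset.exists_mem_eq_inf' hH (err P)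
  refine Finset.card_pos.2 ⟨h₁, Finset.mem_filter.2 ⟨hh₁, ?_⟩⟩
  have e : minErr P H hH = err P h₁ := he
  have : 0 ≤ C₀ * t * rate d n δ₀ :=
    mul_nonneg (mul_nonneg hC₀ (Nat.cast_nonneg t)) (Real.sqrt_nonneg _)
  linarith

/-- Shell sizes are bounded by `|H|`, so the quotient falls below the positive right side for large
`t`. Hence the infimum is attained rather than being the default value `0`. -/
lemma tStar_spec (hC₀ : 0 < C₀) (hα : 0 < α) (hC : 0 < C) (hd : 1 ≤ d) (hn : 2 ≤ n) :
    0 < tStar P H hH d n α δ δ₀ C₀ C ∧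
    Real.log ((shell P H hH d n δ₀ C₀ (tStar P H hH d n α δ δ₀ C₀ C + 1)).card : ℝ)
      + Real.log (1 / δ) ≤
      tStar P H hH d n α δ δ₀ C₀ C * (C₀ * α * Real.sqrt (d * n * Real.log n) / C) := by
  have hn' : (2 : ℝ) ≤ n := by exact_mod_cast hn
  have hd' : (1 : ℝ) ≤ d := by exact_mod_cast hd
  have hlog : 0 < Real.log n := Real.log_pos (by linarith)
  have hR : 0 < C₀ * α * Real.sqrt (d * n * Real.log n) / C := by positivity
  have hmem := Nat.sInf_mem (s := {t : ℕ | 0 < t ∧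
    (Real.log ((shell P H hH d n δ₀ C₀ (t + 1)).card : ℝ) + Real.log (1 / δ)) / t
      ≤ C₀ * α * Real.sqrt (d * n * Real.log n) / C}) (by
    obtain ⟨N, hN⟩ := exists_nat_ge ((Real.log H.card + Real.log (1 / δ)) /
      (C₀ * α * Real.sqrt (d * n * Real.log n) / C))
    refine ⟨N + 1, Nat.succ_pos N, ?_⟩
    rw [div_le_iff₀ hR] at hN
    rw [div_le_iff₀ (by positivity)]
    have h1 : Real.log ((shell P H hH d n δ₀ C₀ (N + 1 + 1)).card : ℝ) ≤ Real.log H.card := by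
      refine Real.log_le_log ?_ ?_
      · exact_mod_cast one_le_card_shell hC₀.le _
      · exact_mod_cast Finset.card_filter_le _ _
    push_cast
    nlinarith)
  obtain ⟨h1, h2⟩ := hmem
  refine ⟨h1, ?_⟩
  rw [div_le_iff₀ (by exact_mod_cast h1)] at h2
  rw [mul_comm]
  exact h2

/-- Bridges the `log n` in the definition of `t*` and the `log (n / δ₀)` in the shell width. -/
lemma sqrt_le_mul_rate (hn : 2 ≤ n) (h0 : 0 < δ₀) (h1 : δ₀ < 1) :
    Real.sqrt (d * n * Real.log n) ≤ n * rate d n δ₀ := by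
  have hn' : (2 : ℝ) ≤ n := by exact_mod_cast hn
  obtain ⟨hl, -⟩ := log_ratio_pos hn h0 h1
  refine Real.sqrt_le_iff.2 ⟨mul_nonneg (by linarith) (Real.sqrt_nonneg _), ?_⟩
  rw [mul_pow, rate, Real.sq_sqrt]
  · have : (n : ℝ) ^ 2 * (d * Real.log (n / δ₀) / n) = d * n * Real.log (n / δ₀) := by
      field_simp
    rw [this]
    gcongr
  · have := (Real.log_nonneg (by linarith : (1 : ℝ) ≤ n)).trans hl
    positivity

/-- On the event of uniform deviation at most `c * rate`, the hypotheses outside the shell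
`t + 1` fall short of the best one. -/
lemma kthHighest_shell_le {D : Fin n → X × Bool} {c κ : ℝ}
    (hD : ∀ h ∈ H, |empErr h D - err P h| ≤ c * rate d n δ₀) {t : ℕ}
    (hκ : κ * C₀ * t ≤ C₀ * (t + 1) - 2 * c)
    (hlt : (shell P H hH d n δ₀ C₀ (t + 1)).card < H.card) :
    kthHighest H (fun h => 1 - empErr h D) ((shell P H hH d n δ₀ C₀ (t + 1)).card + 1) ≤
      kthHighest H (fun h => 1 - empErr h D) 1 - κ * C₀ * t * rate d n δ₀ := by
  refine kthHighest_le hlt (Nat.lt_succ_self _) fun h hh hns => ?_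
  obtain ⟨h₁, hh₁, he⟩ := Finset.exists_mem_eq_inf' hH (err P)
  have e : minErr P H hH = err P h₁ := he
  have h0 : 0 ≤ rate d n δ₀ := Real.sqrt_nonneg _
  have h1 := abs_le.1 (hD h hh)
  have h2 := abs_le.1 (hD h₁ hh₁)
  have h3 := le_kthHighest_one (f := fun h => 1 - empErr h D) hh₁
  have h4 : minErr P H hH + C₀ * ((t + 1 : ℕ) : ℝ) * rate d n δ₀ < err P h := by
    by_contra hcon
    exact hns (Finset.mem_filter.2 ⟨hh, not_lt.1 hcon⟩)
  have h5 := mul_le_mul_of_nonneg_right hκ h0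
  push_cast at h4
  nlinarith

end Learning

/-- For `C₀ = c₀` and `t = 1` the right side vanishes, which is what `hor` excludes. If `t ≥ 2`, it
is at least `C₀ (t - 1) ≥ C₀ t / 2`; if `(1 + θ) c₀ ≤ C₀`, then `c₀ ≤ (1 - κ) C₀`, where `κ` is the
minimum on the left. -/
lemma shell_margin {θ c₀ C₀ t : ℝ} (hθ : 0 < θ) (hC₀ : 0 < C₀) (hc : c₀ ≤ C₀) (ht : 1 ≤ t)
    (hor : (1 + θ) * c₀ ≤ C₀ ∨ 2 ≤ t) :
    min (1 / 2) (θ / (1 + θ)) * C₀ * t ≤ C₀ * (t + 1) - 2 * c₀ := by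
  set κ := min (1 / 2) (θ / (1 + θ)) with hκ
  have hk1 : κ ≤ 1 / 2 := min_le_left _ _
  have hk2 : κ ≤ θ / (1 + θ) := min_le_right _ _
  rcases hor with h | h
  · have h1 : c₀ ≤ C₀ * (1 - κ) := by
      have : c₀ ≤ C₀ / (1 + θ) := by rw [le_div_iff₀ (by linarith)]; linarith
      have e : C₀ / (1 + θ) = C₀ * (1 - θ / (1 + θ)) := by field_simp; ring
      have := mul_le_mul_of_nonneg_left (sub_le_sub_left hk2 1) hC₀.le
      linarith
    have h2 : 0 ≤ C₀ * ((1 - κ) * (t - 1)) :=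
      mul_nonneg hC₀.le (mul_nonneg (by linarith) (by linarith))
    have h3 : 0 ≤ C₀ * κ := mul_nonneg hC₀.le (le_min (by norm_num) (by positivity))
    nlinarith
  · have h1 : κ * C₀ * t ≤ 1 / 2 * C₀ * t := by gcongr
    nlinarith

end PrivMax

/-! ### The accuracy bound -/

open PrivMax
theorem corollary2 :
    ∃ A : ℝ, 0 < A ∧ ∀ θ : ℝ, 0 < θ → ∃ B : ℝ, 0 < B ∧
      ∀ (X : Type*) [MeasurableSpace X] (P : Measure (X × Bool)) [IsProbabilityMeasure P]
        (H : Finset (X → Bool)) (hH : H.Nonempty) (d n : ℕ) (α δ δ₀ C₀ C : ℝ)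
        (top : (Fin n → X × Bool) → ℕ → Finset (X → Bool)),
        (∀ h ∈ H, Measurable h) → vcDim H ≤ d → 1 ≤ d → 2 ≤ n →
        0 < α → α < 1 → 0 < δ → δ < 1 → 0 < δ₀ → δ₀ < 1 →
        0 < C₀ → ucConstant P H d n δ₀ ≤ C₀ → B ≤ C →
        ((1 + θ) * ucConstant P H d n δ₀ ≤ C₀ ∨ 2 ≤ tStar P H hH d n α δ δ₀ C₀ C) →
        (∀ D, ∀ ℓ ∈ Finset.Icc 1 H.card, IsTopSet H (fun h => 1 - empErr h D) ℓ (top D ℓ)) →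
        ENNReal.ofReal (1 - δ₀ - δ) ≤
          ∫⁻ D, lmmProb n α δ H (fun h => 1 - empErr h D) (top D)
              {h | err P h ≤ minErr P H hH + A * (rate d n δ₀ +
                Real.log ((shell P H hH d n δ₀ C₀
                  (tStar P H hH d n α δ δ₀ C₀ C + 1)).card / δ) / (α * n))}
            ∂(Measure.pi fun _ : Fin n => P) := by
  obtain ⟨p, hp⟩ : ∃ p : ℝ, p = Real.exp (-70) / 8 := ⟨_, rfl⟩
  have hp0 : 0 < p := by rw [hp]; positivity
  have hp1 : p ≤ 1 / 8 := by
    have : Real.exp (-70) ≤ 1 := Real.exp_le_one_iff.2 (by norm_num)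
    rw [hp]; linarith
  -- The `16` is twice the uniform bound `8` on `c₀`; the rest is the slack of the exponential
  -- mechanism, with `log 2` absorbed into `lam / p`.
  refine ⟨16 + 6 * (1 + 1 / p), by positivity, fun θ hθ => ?_⟩
  have hκ0 : 0 < min (1 / 2) (θ / (1 + θ)) := lt_min (by norm_num) (by positivity)
  -- The margin has to exceed `60 (lam + 2) + 6 = 60 lam + 126`, and `1 ≤ lam / p` in the case where
  -- it is used.
  refine ⟨(61 + 126 / p) / min (1 / 2) (θ / (1 + θ)), by positivity, ?_⟩
  intro X _ P _ H hH d n α δ δ₀ C₀ C top hmeas hvc hd hn hα hα1 hδ hδ1 hδ₀ hδ₀1 hC₀ hcC hBC hor htop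
  have hn' : (2 : ℝ) ≤ n := by exact_mod_cast hn
  have hC : 0 < C := lt_of_lt_of_le (by positivity) hBC
  obtain ⟨ht0, ht⟩ := tStar_spec (P := P) (H := H) (hH := hH) (δ := δ) (δ₀ := δ₀) hC₀ hα hC hd hn
  set t := tStar P H hH d n α δ δ₀ C₀ C with htdef
  set m := (shell P H hH d n δ₀ C₀ (t + 1)).card with hmdef
  have hm1 : 1 ≤ m := one_le_card_shell hC₀.le _
  have hm' : (1 : ℝ) ≤ m := by exact_mod_cast hm1
  set c₀ := ucConstant P H d n δ₀ with hc₀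
  have hc8 : c₀ ≤ 8 := ucConstant_le_eight P H hmeas hvc hd hn hδ₀ hδ₀1
  set ρ := rate d n δ₀ with hρdef
  have hρ : 0 < ρ := rate_pos hd hn hδ₀ hδ₀1
  set lam := Real.log (m / δ) with hlam
  have hlam_eq : lam = Real.log m + Real.log (1 / δ) := by
    rw [← Real.log_mul (by positivity) (by positivity), hlam]; ring_nf
  have hlam_ge : 1 - δ ≤ lam := by
    have h1 := Real.log_nonneg hm'
    have h2 := Real.log_le_sub_one_of_pos hδ
    rw [hlam_eq, one_div, Real.log_inv]; linarith
  set S : Set (X → Bool) :=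
    {h | err P h ≤ minErr P H hH + (16 + 6 * (1 + 1 / p)) * (ρ + lam / (α * n))} with hS
  set E : Set (Fin n → X × Bool) := {D | ∀ h ∈ H, |empErr h D - err P h| ≤ c₀ * ρ} with hE
  have hEm : MeasurableSet E := measurableSet_uniform_deviation P H hmeas n _
  have hEp := le_measure_ucConstant P H hmeas hvc hd hn hδ₀ hδ₀1
  have hcρ : c₀ * ρ ≤ 8 * ρ := mul_le_mul_of_nonneg_right hc8 hρ.le
  have hq : 0 ≤ lam / (α * n) := div_nonneg (by linarith) (by positivity)
  have hip : 0 < 1 / p := by positivity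
  have hkey : ∀ D ∈ E, ENNReal.ofReal (1 - δ) ≤
      lmmProb n α δ H (fun h => 1 - empErr h D) (top D) S := by
    intro D hD
    -- In the first case `p` already covers the required probability; in the second `lam ≥ 1 - δ >
    -- p`.
    by_cases hcase : 1 - δ ≤ p
    · refine (ENNReal.ofReal_le_ofReal (hcase.trans hp.le)).trans
        (lmmProb_of_half_le (by omega) hα hα1 (by linarith) hδ1 hH (htop D) fun h hh hopt => ?_)
      have h1 := err_le_of_near_optimal (hH := hH) (s := 0) hD hh (by simpa using hopt)
      change err P h ≤ _
      nlinarith [mul_pos hip hρ, mul_nonneg hip.le hq]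
    · have hlp : p ≤ lam := by linarith
      have hlp' : 1 ≤ 1 / p * lam := by
        rw [one_div_mul_eq_div, le_div_iff₀ hp0]; linarith
      have h3m : Real.log (3 * m / δ) ≤ lam + 2 := by
        have e : Real.log (3 * m / δ) = Real.log 3 + lam := by
          rw [hlam, ← Real.log_mul (by norm_num) (by positivity)]; ring_nf
        have := Real.log_le_sub_one_of_pos (by norm_num : (0 : ℝ) < 3)
        linarith
      have h2m : Real.log (2 * m / δ) ≤ (1 + 1 / p) * lam := by
        have e : Real.log (2 * m / δ) = Real.log 2 + lam := by
          rw [hlam, ← Real.log_mul (by norm_num) (by positivity)]; ring_nf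
        have := Real.log_le_sub_one_of_pos (by norm_num : (0 : ℝ) < 2)
        linarith
      refine lmmProb_of_margin (by omega) hα hα1 hδ hδ1 hH (htop D) hm1
        (g := min (1 / 2) (θ / (1 + θ)) * C₀ * t * ρ) ?_ ?_ ?_
      · set κ := min (1 / 2) (θ / (1 + θ)) with hκ
        have h1 : lam * C ≤ t * (C₀ * α * (n * ρ)) := by
          rw [← hlam_eq, mul_div_assoc', le_div_iff₀ hC] at ht
          refine ht.trans ?_
          gcongr
          exact sqrt_le_mul_rate hn hδ₀ hδ₀1
        have h2 : 61 + 126 / p ≤ κ * C := by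
          rw [div_le_iff₀ hκ0] at hBC; linarith
        have h3 : (61 + 126 / p) * lam ≤ n * α * (κ * C₀ * t * ρ) := by
          calc (61 + 126 / p) * lam ≤ κ * C * lam :=
                mul_le_mul_of_nonneg_right h2 (by linarith)
            _ = κ * (lam * C) := by ring
            _ ≤ κ * (t * (C₀ * α * (n * ρ))) := mul_le_mul_of_nonneg_left h1 hκ0.le
            _ = _ := by ring
        have h4 : (61 + 126 / p) * lam = 61 * lam + 126 * (1 / p * lam) := by ring
        linarith
      · refine kthHighest_shell_le hD (shell_margin hθ hC₀ hcC (by exact_mod_cast ht0) ?_)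
        exact hor.imp_right fun h => by exact_mod_cast h
      · intro h hh hopt
        have h1 := err_le_of_near_optimal (hH := hH) hD hh hopt
        change err P h ≤ _
        have h2 : 6 / (n * α) * Real.log (2 * m / δ) ≤ 6 * (1 + 1 / p) * (lam / (α * n)) := by
          calc 6 / (n * α) * Real.log (2 * m / δ) ≤ 6 / (n * α) * ((1 + 1 / p) * lam) :=
                mul_le_mul_of_nonneg_left h2m (by positivity)
            _ = _ := by ring
        nlinarith [mul_pos hip hρ]
  calc ENNReal.ofReal (1 - δ₀ - δ) ≤ ENNReal.ofReal ((1 - δ) * (1 - δ₀)) :=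
        ENNReal.ofReal_le_ofReal (by nlinarith)
    _ = ENNReal.ofReal (1 - δ) * ENNReal.ofReal (1 - δ₀) := ENNReal.ofReal_mul (by linarith)
    _ ≤ ENNReal.ofReal (1 - δ) * (Measure.pi fun _ : Fin n => P) E := by gcongr
    _ = ∫⁻ _ in E, ENNReal.ofReal (1 - δ) ∂(Measure.pi fun _ : Fin n => P) :=
        (setLIntegral_const _ _).symm
    _ ≤ ∫⁻ D in E, lmmProb n α δ H (fun h => 1 - empErr h D) (top D) S
          ∂(Measure.pi fun _ : Fin n => P) := setLIntegral_mono' hEm hkey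
    _ ≤ _ := setLIntegral_le_lintegral _ _
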